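/- A PC prograph of size $n\ge 1$ is a connected oriented plane graph without oriented cycles whose vertices are $n$ coproducts (one input below, a left and a right output above) and $n$ products (a left and a right input below, one output above), in which every output is joined by an edge to one input, except that the input of exactly one coproduct and the output of exactly one product are left free; the free input and the free output lie on the outer face, and prographs are considered up to orientation-preserving isomorphism of plane graphs respecting this structure. The two classical rotations are: (a) for coproducts, if the right output of a coproduct $x$ is joined to the input of a coproduct $y$, replace $(a,(b,c))$ by $((a,b),c)$, where $a$, $b$, $c$ are, from left to right, the three upper edges of the pair $x,y$; (b) for products, if the output of a product $y$ is joined to the left input of a product $x$, replace $((a,b),c)$ by $(a,(b,c))$, where $a$, $b$, $c$ are, from left to right, the three lower edges of the pair. All other edges are unchanged. Let $n\ge 1$, and let $\mathcal A_n$ be the set of PC prographs of size $n$ with no edge from the output of a product to the input of a coproduct. Let $\mathcal T_n$ be the Tamari lattice, i.e. the set of binary trees with $n$ nodes, where $S\le T$ if $T$ is obtained from $S$ by a sequence of right rotations $((a,b),c)\mapsto(a,(b,c))$. 1. A PC prograph of size $n$ belongs to $\mathcal A_n$ if and only if it is the gluing of a tree $S$ formed by its $n$ coproducts with a tree $T$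 formed by its $n$ products, that is, the $k$-th leaf of $S$, from left to right, is joined to the $k$-th leaf of $T$ for $k=1,\dots,n+1$, the free input being the root of $S$ and the free output the root of $T$. 2. $\mathcal T_n$ is a lattice, and $\mathcal A_n$, ordered by $Q\le R$ if $R$ is obtained from $Q$ by a sequence of rotations (a) and (b), is a lattice. There is an isomorphism of lattices $\mathcal A_n\cong\mathcal T_n\times\mathcal T_n$, which sends the gluing of $S$ with $T$ to $(\overline S,T)$, where $\overline S$ is the mirror image of $S$ (the tree of coproducts turned by half a turn, so that it hangs from its root like a tree of products). -/

import Mathlib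

/-! ### Product-coproduct prographs as plane graphs

The objects are plane graphs, encoded as combinatorial maps: every vertex carries named half-edges
(ports), the edges match the ports, and the cyclic order of the ports around a vertex determines
the faces.  `C` and `P` are the (finite) types of coproducts and of products. -/

/-- The outputs of the operators: each coproduct has a left and a right output, each product has
one output. -/
inductive OutPort (C P : Type) : Type where
  | copL (c : C) : OutPort C P
  | copR (c : C) : OutPort C P
  | prod (p : P) : OutPort C P

/-- The inputs of the operators: each coproduct has one input, each product has a left and a
right input. -/
inductive InPort (C P : Type) : Type where
  | cop (c : C) : InPort C P
  | prodL (p : P) : InPort C P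
  | prodR (p : P) : InPort C P

/-- The operator that owns an output. -/
def OutPort.vertex {C P : Type} : OutPort C P → C ⊕ P
  | .copL c => Sum.inl c
  | .copR c => Sum.inl c
  | .prod p => Sum.inr p

/-- The operator that owns an input. -/
def InPort.vertex {C P : Type} : InPort C P → C ⊕ P
  | .cop c => Sum.inl c
  | .prodL p => Sum.inr p
  | .prodR p => Sum.inr p

/-- Renaming the operators that own the outputs. -/
def OutPort.map {C P C' P' : Type} (f : C → C') (g : P → P') : OutPort C P → OutPort C' P'
  | .copL c => .copL (f c)
  | .copR c => .copR (f c)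
  | .prod p => .prod (g p)

/-- Renaming the operators that own the inputs. -/
def InPort.map {C P C' P' : Type} (f : C → C') (g : P → P') : InPort C P → InPort C' P'
  | .cop c => .cop (f c)
  | .prodL p => .prodL (g p)
  | .prodR p => .prodR (g p)

/-- A half-edge. -/
abbrev Dart (C P : Type) : Type := OutPort C P ⊕ InPort C P

/-- The counterclockwise rotation of the half-edges around each vertex, where inputs are drawn
below the vertex and outputs above it: `(input, right output, left output)` around a coproduct and
`(left input, right input, output)` around a product. -/
def dartRotation (C P : Type) : Equiv.Perm (Dart C P) where
  toFun
    | .inr (.cop c) => .inl (.copR c)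
    | .inl (.copR c) => .inl (.copL c)
    | .inl (.copL c) => .inr (.cop c)
    | .inr (.prodL p) => .inr (.prodR p)
    | .inr (.prodR p) => .inl (.prod p)
    | .inl (.prod p) => .inr (.prodL p)
  invFun
    | .inl (.copR c) => .inr (.cop c)
    | .inl (.copL c) => .inl (.copR c)
    | .inr (.cop c) => .inl (.copL c)
    | .inr (.prodR p) => .inr (.prodL p)
    | .inl (.prod p) => .inr (.prodR p)
    | .inr (.prodL p) => .inl (.prod p)
  left_inv := by rintro ((c | c | p) | (c | p | p)) <;> rfl
  right_inv := by rintro ((c | c | p) | (c | p | p)) <;> rfl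

/-- The involution that exchanges the two half-edges of each edge. -/
def edgeFlip {C P : Type} (w : OutPort C P ≃ InPort C P) : Equiv.Perm (Dart C P) where
  toFun
    | .inl o => .inr (w o)
    | .inr i => .inl (w.symm i)
  invFun
    | .inl o => .inr (w o)
    | .inr i => .inl (w.symm i)
  left_inv := by rintro (o | i) <;> simp
  right_inv := by rintro (o | i) <;> simp

/-- The faces of the embedded graph: the orbits of "cross the edge, then turn at the vertex". -/
def Faces {C P : Type} (w : OutPort C P ≃ InPort C P) : Type :=
  Quotient (Equiv.Perm.SameCycle.setoid ((edgeFlip w).trans (dartRotation C P)))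

/-- There is an edge from operator `x` to operator `y`, other than the edge that leaves the output
of the product `north`. -/
def EdgeRel {C P : Type} (w : OutPort C P ≃ InPort C P) (north : P) (x y : C ⊕ P) : Prop :=
  ∃ o : OutPort C P, o ≠ .prod north ∧ o.vertex = x ∧ (w o).vertex = y

/-- A PC prograph with set of coproducts `C` and set of products `P`.

Each output is joined to one input, except that the output of one product `north` and the input of
one coproduct `south` are left unconnected.  In the prograph drawn on the sphere, these two are
joined by an additional *closing edge*, which runs outside of the drawing; `wire` records all the
edges on the sphere, the closing edge included.  The prograph itself (without the closing edge) is
connected and has no oriented cycle, and the graph on the sphere is planar (Euler's formula), so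
that the free input and the free output lie on a common face of the prograph. -/
structure LabelledPrograph (C P : Type) : Type where
  wire : OutPort C P ≃ InPort C P
  north : P
  south : C
  closing : wire (.prod north) = .cop south
  connected : (SimpleGraph.fromRel (EdgeRel wire north)).Connected
  acyclic : ∀ x : C ⊕ P, ¬ Relation.TransGen (EdgeRel wire north) x x
  planar : Nat.card (C ⊕ P) + Nat.card (Faces wire) = Nat.card (OutPort C P) + 2

namespace LabelledPrograph

variable {C P : Type}

/-- Two prographs that differ by the names of their operators. -/
def Iso {C' P' : Type} (G : LabelledPrograph C P) (H : LabelledPrograph C' P') : Prop :=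
  ∃ (f : C ≃ C') (g : P ≃ P'), g G.north = H.north ∧
    ∀ o : OutPort C P, H.wire (o.map f g) = (G.wire o).map f g

/-- Some edge of the prograph goes from the output of a product to the input of a coproduct. -/
def HasProdCopEdge (G : LabelledPrograph C P) : Prop :=
  ∃ (p : P) (c : C), p ≠ G.north ∧ G.wire (.prod p) = .cop c

/-- The rotation of coproducts: the right output of the coproduct `x` enters the coproduct `y`;
afterwards the left output of `x` enters `y`.  The three upper edges keep their order from
left to right, and all the other edges are unchanged. -/
def CopRotation (G H : LabelledPrograph C P) : Prop :=
  H.north = G.north ∧ ∃ x y : C, G.wire (.copR x) = .cop y ∧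
    H.wire (.copL x) = .cop y ∧
    H.wire (.copL y) = G.wire (.copL x) ∧
    H.wire (.copR y) = G.wire (.copL y) ∧
    H.wire (.copR x) = G.wire (.copR y) ∧
    (∀ z : C, z ≠ x → z ≠ y →
      H.wire (.copL z) = G.wire (.copL z) ∧ H.wire (.copR z) = G.wire (.copR z)) ∧
    ∀ p : P, H.wire (.prod p) = G.wire (.prod p)

/-- The rotation of products: the left input of the product `x` comes from the product `y`;
afterwards the right input of `x` comes from `y`.  The three lower edges keep their order from
left to right, and all the other edges are unchanged. -/
def ProdRotation (G H : LabelledPrograph C P) : Prop :=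
  H.north = G.north ∧ ∃ x y : P, G.wire.symm (.prodL x) = .prod y ∧
    H.wire.symm (.prodR x) = .prod y ∧
    H.wire.symm (.prodL x) = G.wire.symm (.prodL y) ∧
    H.wire.symm (.prodL y) = G.wire.symm (.prodR y) ∧
    H.wire.symm (.prodR y) = G.wire.symm (.prodR x) ∧
    (∀ z : P, z ≠ x → z ≠ y →
      H.wire.symm (.prodL z) = G.wire.symm (.prodL z) ∧
      H.wire.symm (.prodR z) = G.wire.symm (.prodR z)) ∧
    ∀ c : C, H.wire.symm (.cop c) = G.wire.symm (.cop c)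

/-- `CopTree G e t L`: following the edge `e` upwards through coproducts one reads the
binary tree `t`, whose leaves are, from left to right, the edges in the list `L`, which do not
enter a coproduct.  An edge is named by the output it starts from. -/
inductive CopTree (G : LabelledPrograph C P) :
    OutPort C P → BinaryTree Unit → List (OutPort C P) → Prop where
  | leaf (e : OutPort C P) (he : ∀ c : C, G.wire e ≠ .cop c) : CopTree G e .nil [e]
  | node (e : OutPort C P) (c : C) (he : G.wire e = .cop c) (s t : BinaryTree Unit)
      (K L : List (OutPort C P)) (hs : CopTree G (.copL c) s K) (ht : CopTree G (.copR c) t L) :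
      CopTree G e (.node () s t) (K ++ L)

/-- `ProdTree G e t L`: following the edge `e` downwards through products one reads the binary
tree `t`, whose leaves are, from left to right, the edges in the list `L`, which do not come out
of a product. -/
inductive ProdTree (G : LabelledPrograph C P) :
    OutPort C P → BinaryTree Unit → List (OutPort C P) → Prop where
  | leaf (e : OutPort C P) (he : ∀ p : P, e ≠ .prod p) : ProdTree G e .nil [e]
  | node (p : P) (s t : BinaryTree Unit) (K L : List (OutPort C P))
      (hs : ProdTree G (G.wire.symm (.prodL p)) s K)
      (ht : ProdTree G (G.wire.symm (.prodR p)) t L) :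
      ProdTree G (.prod p) (.node () s t) (K ++ L)

/-- The prograph is the gluing of the tree of coproducts `S` with the tree of products `T`:
all the coproducts form the tree `S`, all the products form the tree `T`, the two roots are the
ends of the closing edge, and the `k`-th leaf of `S` is the `k`-th leaf of `T` for every `k`. -/
def IsGluing (G : LabelledPrograph C P) (S T : BinaryTree Unit) : Prop :=
  S.numNodes = Nat.card C ∧ T.numNodes = Nat.card P ∧
    ∃ L : List (OutPort C P),
      CopTree G (.prod G.north) S L ∧ ProdTree G (.prod G.north) T L

end LabelledPrograph

/-- Renaming the operators is an equivalence relation. -/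
def progSetoid (n : ℕ) : Setoid (LabelledPrograph (Fin n) (Fin n)) where
  r := LabelledPrograph.Iso
  iseqv :=
    { refl := fun G => ⟨Equiv.refl _, Equiv.refl _, rfl, by
        intro o
        have h1 : o.map (Equiv.refl (Fin n)) (Equiv.refl (Fin n)) = o := by cases o <;> rfl
        rw [h1]
        cases G.wire o <;> rfl⟩
      symm := by
        rintro G H ⟨f, g, h1, h2⟩
        refine ⟨f.symm, g.symm, by simp [← h1], fun o => ?_⟩
        have h3 : o = (o.map f.symm g.symm).map f g := by cases o <;> simp [OutPort.map]
        have h4 := h2 (o.map f.symm g.symm)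
        rw [← h3] at h4
        rw [h4]
        cases G.wire (o.map f.symm g.symm) <;> simp [InPort.map]
      trans := by
        rintro G H K ⟨f, g, h1, h2⟩ ⟨f', g', h3, h4⟩
        refine ⟨f.trans f', g.trans g', by simp [h1, h3], fun o => ?_⟩
        have h5 : o.map (f.trans f') (g.trans g') = (o.map f g).map f' g' := by cases o <;> rfl
        rw [h5, h4, h2]
        cases G.wire o <;> rfl }

/-- The PC prographs of size `n` (with `n` coproducts and `n` products), up to the names of
the operators. -/
def PCPrograph (n : ℕ) : Type := Quotient (progSetoid n)

namespace PCPrograph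

variable {n : ℕ}

/-- The prograph represented by a labelled one. -/
def mk (G : LabelledPrograph (Fin n) (Fin n)) : PCPrograph n := Quotient.mk (progSetoid n) G

/-- No edge goes from the output of a product to the input of a coproduct. -/
def AvoidsProdCop (Q : PCPrograph n) : Prop :=
  ∀ G : LabelledPrograph (Fin n) (Fin n), mk G = Q → ¬ G.HasProdCopEdge

/-- `R` arises from `Q` by one of the two classical rotations. -/
def Rotation (Q R : PCPrograph n) : Prop :=
  ∃ G H : LabelledPrograph (Fin n) (Fin n), mk G = Q ∧ mk H = R ∧
    (G.CopRotation H ∨ G.ProdRotation H)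

/-- `Q` is the gluing of the tree of coproducts `S` with the tree of products `T`. -/
def IsGluing (Q : PCPrograph n) (S T : BinaryTree Unit) : Prop :=
  ∃ G : LabelledPrograph (Fin n) (Fin n), mk G = Q ∧ G.IsGluing S T

end PCPrograph

/-- The PC prographs of size `n` without an edge from a product output to a coproduct input. -/
def AvoidingPrograph (n : ℕ) : Type := {Q : PCPrograph n // Q.AvoidsProdCop}

/-- `R` is reached from `Q` by a sequence of classical rotations. -/
def AvoidingPrograph.Reaches {n : ℕ} : AvoidingPrograph n → AvoidingPrograph n → Prop :=
  Relation.ReflTransGen fun Q R => PCPrograph.Rotation Q.1 R.1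

/-- `Q ≤ R` if `R` is reached from `Q` by a sequence of classical rotations. -/
instance (n : ℕ) : LE (AvoidingPrograph n) := ⟨AvoidingPrograph.Reaches⟩

/-! ### The Tamari lattice -/

/-- Right rotation at a node of a binary tree: `((a, b), c) ↦ (a, (b, c))`. -/
inductive RightRotation : BinaryTree Unit → BinaryTree Unit → Prop where
  | root (a b c : BinaryTree Unit) :
      RightRotation (.node () (.node () a b) c) (.node () a (.node () b c))
  | left (a a' b : BinaryTree Unit) (h : RightRotation a a') :
      RightRotation (.node () a b) (.node () a' b)
  | right (a b b' : BinaryTree Unit) (h : RightRotation b b') :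
      RightRotation (.node () a b) (.node () a b')

/-- The binary trees with `n` nodes. -/
def Tamari (n : ℕ) : Type := {t : BinaryTree Unit // t.numNodes = n}

/-- `T` is reached from `S` by a sequence of right rotations. -/
def Tamari.Reaches {n : ℕ} (S T : Tamari n) : Prop := Relation.ReflTransGen RightRotation S.1 T.1

/-- `S ≤ T` in the Tamari order if `T` is reached from `S` by a sequence of right rotations. -/
instance (n : ℕ) : LE (Tamari n) := ⟨Tamari.Reaches⟩

/-- The mirror image of a binary tree.  A tree of coproducts grows upwards; turning it by half a
turn, so that it hangs from its root like a tree of products, gives the mirror image of the tree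
read from left to right. -/
def mirror : BinaryTree Unit → BinaryTree Unit
  | .nil => .nil
  | .node _ a b => .node () (mirror b) (mirror a)

/-!
Without an edge from a product to a coproduct, acyclicity makes the coproducts unfold into one
tree and the products into another, and the remaining edges match the leaves of the first with the
leaves of the second. Every face meets one of the `n + 2` gaps to the left of, between and to the
right of the leaves of the tree of products. Euler's formula asks for `n + 2` faces, so the gaps lie
on pairwise different faces; since each tree, read from left to right, has the face to the right of
a leaf as the face to the left of the next one, the leaves of the two trees come in the same order.
A rotation of a gluing rotates one of the two trees, and every rotation of either tree arises in
this way.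

The Tamari order is the pointwise order of bracket vectors. A tree is determined by its bracket
vector, and pointwise minima of bracket vectors are bracket vectors, which gives meets; taking
mirror images reverses the order and gives joins.
-/

open Relation

/-! ### Bracket vectors and the Tamari lattice -/

/-- The bracket vector of Huang and Tamari: with the nodes numbered from `0` in inorder, the number
of the last node in the right subtree of the `i`-th node, or `i` if that subtree is empty. -/
def rightEnd : BinaryTree Unit → ℕ → ℕ
  | .nil, i => i
  | .node _ a b, i =>
    if i < a.numNodes then rightEnd a i
    else if i = a.numNodes then a.numNodes + b.numNodes
    else a.numNodes + 1 + rightEnd b (i - (a.numNodes + 1))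

theorem rightEnd_node_of_lt {a : BinaryTree Unit} (b : BinaryTree Unit) {i : ℕ}
    (hi : i < a.numNodes) : rightEnd (.node () a b) i = rightEnd a i :=
  if_pos hi

theorem rightEnd_node_numNodes (a b : BinaryTree Unit) :
    rightEnd (.node () a b) a.numNodes = a.numNodes + b.numNodes := by
  simp [rightEnd]

theorem rightEnd_node_add (a b : BinaryTree Unit) (i : ℕ) :
    rightEnd (.node () a b) (a.numNodes + 1 + i) = a.numNodes + 1 + rightEnd b i := by
  have h1 : ¬ a.numNodes + 1 + i < a.numNodes := by omega
  have h2 : a.numNodes + 1 + i ≠ a.numNodes := by omega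
  simp [rightEnd, h1, h2]

/-- The properties that characterize the bracket vectors of the binary trees with `n` nodes, among
the functions restricted to `i < n`. -/
structure IsBracketVector (n : ℕ) (f : ℕ → ℕ) : Prop where
  le : ∀ i < n, i ≤ f i
  lt : ∀ i < n, f i < n
  nested : ∀ i < n, ∀ j, i ≤ j → j ≤ f i → f j ≤ f i

theorem isBracketVector_rightEnd (t : BinaryTree Unit) :
    IsBracketVector t.numNodes (rightEnd t) := by
  induction t with
  | nil => exact ⟨by simp, by simp, by simp⟩
  | node _ a b iha ihb =>
    refine ⟨fun i hi => ?_, fun i hi => ?_, fun i hi j hij hj => ?_⟩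
    · have := iha.le i
      have := ihb.le (i - (a.numNodes + 1))
      grind [rightEnd, BinaryTree.numNodes]
    · have := iha.lt i
      have := ihb.lt (i - (a.numNodes + 1))
      grind [rightEnd, BinaryTree.numNodes]
    · have := iha.lt i
      have := iha.nested i
      have := ihb.lt (j - (a.numNodes + 1))
      have := ihb.nested (i - (a.numNodes + 1))
      grind [rightEnd, BinaryTree.numNodes]

theorem IsBracketVector.min {n : ℕ} {f g : ℕ → ℕ} (hf : IsBracketVector n f)
    (hg : IsBracketVector n g) : IsBracketVector n fun i => min (f i) (g i) where
  le i hi := le_min (hf.le i hi) (hg.le i hi)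
  lt i hi := (min_le_left _ _).trans_lt (hf.lt i hi)
  nested i hi j hij hj := le_min
    ((min_le_left _ _).trans (hf.nested i hi j hij (hj.trans (min_le_left _ _))))
    ((min_le_right _ _).trans (hg.nested i hi j hij (hj.trans (min_le_right _ _))))

theorem IsBracketVector.take {n k : ℕ} {f : ℕ → ℕ} (hf : IsBracketVector n f) (hk : k ≤ n)
    (h : ∀ i < k, f i < k) : IsBracketVector k f where
  le i hi := hf.le i (by omega)
  lt := h
  nested i hi := hf.nested i (by omega)

theorem IsBracketVector.drop {m n : ℕ} {f : ℕ → ℕ} (hf : IsBracketVector (m + n) f) :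
    IsBracketVector n fun i => f (m + i) - m where
  le i hi := by
    have := hf.le (m + i) (by omega)
    omega
  lt i hi := by
    have := hf.lt (m + i) (by omega)
    omega
  nested i hi j hij hj := by
    have := hf.le (m + i) (by omega)
    have := hf.nested (m + i) (by omega) (m + j) (by omega) (by omega)
    omega

-- The root of the tree is its first node whose right subtree extends to the last node.
theorem IsBracketVector.exists_root {n : ℕ} {f : ℕ → ℕ} (hf : IsBracketVector (n + 1) f) :
    ∃ k ≤ n, f k = n ∧ ∀ i < k, f i < k := by
  have hlast : f n = n := by
    have := hf.le n (by omega)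
    have := hf.lt n (by omega)
    omega
  classical
  have hex : ∃ k, f k = n := ⟨n, hlast⟩
  have hle : Nat.find hex ≤ n := Nat.find_min' hex hlast
  refine ⟨Nat.find hex, hle, Nat.find_spec hex, fun i hi => ?_⟩
  by_contra! hcon
  have h := hf.nested i (by omega) _ hi.le hcon
  rw [Nat.find_spec hex] at h
  have := hf.lt i (by omega)
  exact Nat.find_min hex hi (by omega)

theorem IsBracketVector.exists_rightEnd_eq {n : ℕ} {f : ℕ → ℕ} (hf : IsBracketVector n f) :
    ∃ t : BinaryTree Unit, t.numNodes = n ∧ ∀ i < n, rightEnd t i = f i := by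
  induction n using Nat.strong_induction_on generalizing f with
  | _ n ih =>
    rcases n with _ | n
    · exact ⟨.nil, rfl, by simp⟩
    obtain ⟨k, hkn, hk, hpre⟩ := hf.exists_root
    obtain ⟨m, rfl⟩ := Nat.exists_eq_add_of_le hkn
    have hdrop : IsBracketVector m fun i => f (k + 1 + i) - (k + 1) :=
      IsBracketVector.drop (by rwa [add_right_comm])
    obtain ⟨a, rfl, ha⟩ := ih k (by omega) (hf.take (by omega) hpre)
    obtain ⟨b, rfl, hb⟩ := ih m (by omega) hdrop
    refine ⟨.node () a b, rfl, fun i hi => ?_⟩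
    obtain h | rfl | h := lt_trichotomy i a.numNodes
    · rw [rightEnd_node_of_lt b h, ha i h]
    · rw [rightEnd_node_numNodes, hk]
    · obtain ⟨j, rfl⟩ := Nat.exists_eq_add_of_le (show a.numNodes + 1 ≤ i from h)
      have := hf.le _ hi
      rw [rightEnd_node_add, hb j (by omega)]
      omega

namespace RightRotation

theorem numNodes_eq {S T : BinaryTree Unit} (h : RightRotation S T) :
    S.numNodes = T.numNodes := by
  induction h with
  | root a b c => simp only [BinaryTree.numNodes]; omega
  | left a a' b _ ih => simp only [BinaryTree.numNodes, ih]
  | right a b b' _ ih => simp only [BinaryTree.numNodes, ih]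

theorem rightEnd_le {S T : BinaryTree Unit} (h : RightRotation S T) (i : ℕ) :
    rightEnd S i ≤ rightEnd T i := by
  induction h generalizing i with
  | root a b c =>
    have : i - (a.numNodes + 1) - (b.numNodes + 1) = i - (a.numNodes + b.numNodes + 1 + 1) := by
      omega
    grind [rightEnd, BinaryTree.numNodes]
  | left a a' b h ih =>
    have := h.numNodes_eq
    grind [rightEnd]
  | right a b b' h ih =>
    have := h.numNodes_eq
    grind [rightEnd]

theorem exists_rightEnd_lt {S T : BinaryTree Unit} (h : RightRotation S T) :
    ∃ i < S.numNodes, rightEnd S i < rightEnd T i := by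
  induction h with
  | root a b c => exact ⟨a.numNodes, by grind [rightEnd, BinaryTree.numNodes]⟩
  | left a a' b h ih =>
    obtain ⟨i, hi, hlt⟩ := ih
    have hi' : i < a'.numNodes := h.numNodes_eq ▸ hi
    refine ⟨i, by simp only [BinaryTree.numNodes]; omega, ?_⟩
    rwa [rightEnd_node_of_lt b hi, rightEnd_node_of_lt b hi']
  | right a b b' _ ih =>
    obtain ⟨i, hi, hlt⟩ := ih
    refine ⟨a.numNodes + 1 + i, by simp only [BinaryTree.numNodes]; omega, ?_⟩
    rw [rightEnd_node_add, rightEnd_node_add]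
    omega

theorem mirror {S T : BinaryTree Unit} (h : RightRotation S T) :
    RightRotation (_root_.mirror T) (_root_.mirror S) := by
  induction h with
  | root a b c => exact .root _ _ _
  | left a a' b _ ih => exact .right _ _ _ ih
  | right a b b' _ ih => exact .left _ _ _ ih

end RightRotation

theorem mirror_mirror (t : BinaryTree Unit) : mirror (mirror t) = t := by
  induction t with
  | nil => rfl
  | node _ a b iha ihb => simp only [mirror, iha, ihb]

theorem numNodes_mirror (t : BinaryTree Unit) : (mirror t).numNodes = t.numNodes := by
  induction t with
  | nil => rfl
  | node _ a b iha ihb => simp only [mirror, BinaryTree.numNodes, iha, ihb, add_comm]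

namespace Tamari

theorem reflTransGen_node_left {a a' : BinaryTree Unit} (b : BinaryTree Unit)
    (h : ReflTransGen RightRotation a a') :
    ReflTransGen RightRotation (.node () a b) (.node () a' b) :=
  h.lift (fun t => BinaryTree.node () t b) fun _ _ => RightRotation.left _ _ _

theorem reflTransGen_node_right (a : BinaryTree Unit) {b b' : BinaryTree Unit}
    (h : ReflTransGen RightRotation b b') :
    ReflTransGen RightRotation (.node () a b) (.node () a b') :=
  h.lift (fun t => BinaryTree.node () a t) fun _ _ => RightRotation.right _ _ _

theorem numNodes_eq_of_reflTransGen {S T : BinaryTree Unit}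
    (h : ReflTransGen RightRotation S T) : S.numNodes = T.numNodes := by
  induction h with
  | refl => rfl
  | tail _ h ih => rw [ih, h.numNodes_eq]

theorem rightEnd_le_of_reflTransGen {S T : BinaryTree Unit}
    (h : ReflTransGen RightRotation S T) (i : ℕ) : rightEnd S i ≤ rightEnd T i := by
  induction h with
  | refl => rfl
  | tail _ h ih => exact ih.trans (h.rightEnd_le i)

theorem reflTransGen_antisymm {S T : BinaryTree Unit} (h : ReflTransGen RightRotation S T)
    (h' : ReflTransGen RightRotation T S) : S = T := by
  rcases ReflTransGen.cases_head h with rfl | ⟨S', hS, hT⟩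
  · rfl
  · obtain ⟨i, -, hi⟩ := hS.exists_rightEnd_lt
    exact absurd (rightEnd_le_of_reflTransGen (hT.trans h') i) hi.not_ge

-- The hypothesis says that the `k`-th node lies in no right subtree, hence on the left spine.
theorem exists_reflTransGen_node {S : BinaryTree Unit} {k : ℕ} (hk : k < S.numNodes)
    (h : ∀ i < k, rightEnd S i < k) :
    ∃ a b, a.numNodes = k ∧ ReflTransGen RightRotation S (.node () a b) ∧
      (∀ i < k, rightEnd a i = rightEnd S i) ∧
      ∀ i < b.numNodes, k + 1 + rightEnd b i = rightEnd S (k + 1 + i) := by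
  induction S with
  | nil => simp at hk
  | node _ S T ihS ihT =>
    obtain hlt | rfl | hlt := lt_trichotomy S.numNodes k
    · have hroot := h _ hlt
      rw [rightEnd_node_numNodes] at hroot
      simp only [BinaryTree.numNodes] at hk
      omega
    · exact ⟨S, T, rfl, .refl, fun i hi => (rightEnd_node_of_lt T hi).symm,
        fun i _ => (rightEnd_node_add S T i).symm⟩
    · obtain ⟨a, b, rfl, hr, ha, hb⟩ := ihS hlt fun i hi => by
        simpa only [rightEnd_node_of_lt T (hi.trans hlt)] using h i hi
      have hn := numNodes_eq_of_reflTransGen hr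
      refine ⟨a, .node () b T, rfl, (reflTransGen_node_left T hr).tail (.root a b T),
        fun i hi => by rw [rightEnd_node_of_lt T (hi.trans hlt), ha i hi], fun i _ => ?_⟩
      have := hb i
      have : a.numNodes + 1 + i - (S.numNodes + 1) = i - (b.numNodes + 1) := by
        simp only [BinaryTree.numNodes] at hn
        omega
      grind [rightEnd, BinaryTree.numNodes]

theorem reflTransGen_of_rightEnd_le {S T : BinaryTree Unit} (hn : S.numNodes = T.numNodes)
    (h : ∀ i < T.numNodes, rightEnd S i ≤ rightEnd T i) : ReflTransGen RightRotation S T := by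
  induction T generalizing S with
  | nil =>
    cases S with
    | nil => exact .refl
    | node _ a b => simp at hn
  | node _ A B ihA ihB =>
    simp only [BinaryTree.numNodes] at hn h
    have hroot : ∀ i < A.numNodes, rightEnd S i < A.numNodes := fun i hi => by
      have := h i (by omega)
      rw [rightEnd_node_of_lt B hi] at this
      exact this.trans_lt ((isBracketVector_rightEnd A).lt i hi)
    obtain ⟨a, b, hA, hr, ha, hb⟩ := exists_reflTransGen_node (by omega) hroot
    have hB := numNodes_eq_of_reflTransGen hr
    simp only [BinaryTree.numNodes] at hB
    have hleft : ReflTransGen RightRotation a A := ihA hA fun i hi => by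
      rw [ha i hi, ← rightEnd_node_of_lt B hi]
      exact h i (by omega)
    have hright : ReflTransGen RightRotation b B := ihB (by omega) fun i hi => by
      have := h (A.numNodes + 1 + i) (by omega)
      rw [rightEnd_node_add, ← hb i (by omega)] at this
      omega
    exact hr.trans ((reflTransGen_node_left b hleft).trans (reflTransGen_node_right A hright))

variable {n : ℕ}

theorem reaches_iff (S T : Tamari n) :
    S.Reaches T ↔ ∀ i < n, rightEnd S.1 i ≤ rightEnd T.1 i :=
  ⟨fun h i _ => rightEnd_le_of_reflTransGen h i,
    fun h => reflTransGen_of_rightEnd_le (S.2.trans T.2.symm) (by rwa [T.2])⟩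

theorem exists_glb (S T : Tamari n) :
    ∃ M : Tamari n, M.Reaches S ∧ M.Reaches T ∧
      ∀ M' : Tamari n, M'.Reaches S → M'.Reaches T → M'.Reaches M := by
  have hS := isBracketVector_rightEnd S.1
  have hT := isBracketVector_rightEnd T.1
  rw [S.2] at hS
  rw [T.2] at hT
  obtain ⟨M, hMn, hM⟩ := (hS.min hT).exists_rightEnd_eq
  refine ⟨⟨M, hMn⟩, (reaches_iff _ _).2 fun i hi => (hM i hi).trans_le (min_le_left _ _),
    (reaches_iff _ _).2 fun i hi => (hM i hi).trans_le (min_le_right _ _),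
    fun M' h h' => (reaches_iff _ _).2 fun i hi => ?_⟩
  rw [hM i hi]
  exact le_min ((reaches_iff _ _).1 h i hi) ((reaches_iff _ _).1 h' i hi)

/-- The order-reversing involution of the Tamari lattice that mirrors the trees. -/
protected def mirror (T : Tamari n) : Tamari n :=
  ⟨_root_.mirror T.1, (numNodes_mirror T.1).trans T.2⟩

protected theorem mirror_mirror (T : Tamari n) : T.mirror.mirror = T :=
  Subtype.ext (_root_.mirror_mirror T.1)

theorem Reaches.mirror {S T : Tamari n} (h : S.Reaches T) : T.mirror.Reaches S.mirror :=
  ReflTransGen.lift _root_.mirror (fun _ _ => RightRotation.mirror) _ _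
    (reflTransGen_swap.2 h)

theorem exists_lub (S T : Tamari n) :
    ∃ M : Tamari n, S.Reaches M ∧ T.Reaches M ∧
      ∀ M' : Tamari n, S.Reaches M' → T.Reaches M' → M.Reaches M' := by
  obtain ⟨M, hS, hT, hM⟩ := exists_glb S.mirror T.mirror
  refine ⟨M.mirror, ?_, ?_, fun M' h h' => ?_⟩
  · simpa only [Tamari.mirror_mirror] using hS.mirror
  · simpa only [Tamari.mirror_mirror] using hT.mirror
  · simpa only [Tamari.mirror_mirror] using (hM _ h.mirror h'.mirror).mirror

theorem exists_lattice (n : ℕ) :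
    ∃ L : Lattice (Tamari n), ∀ S T : Tamari n, L.le S T ↔ S.Reaches T := by
  choose inf inf_left inf_right le_inf using exists_glb (n := n)
  choose sup left_sup right_sup sup_le using exists_lub (n := n)
  exact ⟨{  le := Reaches
            le_refl := fun _ => .refl
            le_trans := fun _ _ _ => .trans
            le_antisymm := fun _ _ h h' => Subtype.ext (reflTransGen_antisymm h h')
            inf := inf
            inf_le_left := inf_left
            inf_le_right := inf_right
            le_inf := fun M S T => le_inf S T M
            sup := sup
            le_sup_left := left_sup
            le_sup_right := right_sup
            sup_le := fun S T M => sup_le S T M }, fun _ _ => Iff.rfl⟩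

end Tamari

/-! ### Labelled binary trees -/

/-- A list in which every element of the type occurs exactly once. -/
structure IsEnumeration {A : Type} (l : List A) : Prop where
  nodup : l.Nodup
  mem : ∀ a, a ∈ l

namespace IsEnumeration

variable {A B : Type} {l : List A} {m : List B}

theorem length_eq (h : IsEnumeration l) : l.length = Nat.card A := by
  classical
  rw [Nat.card_congr (h.nodup.getEquivOfForallMemList l h.mem).symm, Nat.card_fin]

theorem of_mem_of_length_eq (h : ∀ a, a ∈ l) (hl : l.length = Nat.card A) : IsEnumeration l := by
  classical
  let _ : Fintype A := ⟨l.toFinset, fun a => List.mem_toFinset.2 (h a)⟩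
  refine ⟨(Multiset.toFinset_card_eq_card_iff_nodup (m := (l : Multiset A))).1 ?_, h⟩
  rw [Multiset.coe_card, hl, Nat.card_eq_fintype_card, ← Finset.card_univ]
  exact congrArg Finset.card (Finset.eq_univ_iff_forall.2 fun a => by simp [h a])

theorem of_nodup_of_length_eq [Finite A] (h : l.Nodup) (hl : l.length = Nat.card A) :
    IsEnumeration l := by
  classical
  let _ := Fintype.ofFinite A
  refine ⟨h, fun a => List.mem_toFinset.1 (Finset.eq_univ_iff_forall.1
    ((Finset.card_eq_iff_eq_univ _).1 ?_) a)⟩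
  rw [List.toFinset_card_of_nodup h, hl, Nat.card_eq_fintype_card]

theorem perm (h : IsEnumeration l) {l' : List A} (hp : l.Perm l') : IsEnumeration l' :=
  ⟨hp.nodup_iff.1 h.nodup, fun a => hp.mem_iff.1 (h.mem a)⟩

theorem map (h : IsEnumeration l) (e : A ≃ B) : IsEnumeration (l.map e) :=
  ⟨h.nodup.map e.injective, fun b => List.mem_map.2 ⟨e.symm b, h.mem _, e.apply_symm_apply b⟩⟩

theorem exists_equiv_map_eq (hl : IsEnumeration l) (hm : IsEnumeration m)
    (h : l.length = m.length) : ∃ e : A ≃ B, l.map e = m := by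
  classical
  refine ⟨(hl.nodup.getEquivOfForallMemList l hl.mem).symm.trans
    ((finCongr h).trans (hm.nodup.getEquivOfForallMemList m hm.mem)), ?_⟩
  refine List.ext_getElem (by simpa using h) fun i hi _ => ?_
  rw [List.length_map] at hi
  have hsymm : (hl.nodup.getEquivOfForallMemList l hl.mem).symm l[i] = ⟨i, hi⟩ := by
    rw [Equiv.symm_apply_eq]
    rfl
  simp only [List.getElem_map, Equiv.trans_apply, hsymm]
  rfl

end IsEnumeration

section LabelledTrees

variable {N N' : Type}

/-- The labels of the nodes of a tree, in preorder. -/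
def labels : BinaryTree N → List N
  | .nil => []
  | .node c s t => c :: (labels s ++ labels t)

/-- The unlabelled tree that underlies a labelled one. -/
def shape (t : BinaryTree N) : BinaryTree Unit := t.map fun _ => ()

theorem length_labels (t : BinaryTree N) : (labels t).length = t.numNodes := by
  induction t with
  | nil => rfl
  | node c s t ihs iht => simp [labels, ihs, iht]

theorem numNodes_shape (t : BinaryTree N) : (shape t).numNodes = t.numNodes := by
  induction t with
  | nil => rfl
  | node c s t ihs iht => simpa [shape, BinaryTree.map] using congrArg₂ (· + ·) ihs iht

theorem length_labels_eq_of_shape_eq {s : BinaryTree N} {t : BinaryTree N'}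
    (h : shape s = shape t) : (labels s).length = (labels t).length := by
  rw [length_labels, length_labels, ← numNodes_shape s, ← numNodes_shape t, h]

theorem labels_map (f : N → N') (t : BinaryTree N) : labels (t.map f) = (labels t).map f := by
  induction t with
  | nil => rfl
  | node c s t ihs iht => simp [labels, BinaryTree.map, ihs, iht]

theorem shape_map (f : N → N') (t : BinaryTree N) : shape (t.map f) = shape t :=
  (BinaryTree.comp_map f _ t).symm

theorem eq_of_shape_eq_of_labels_eq {s t : BinaryTree N} (h : shape s = shape t)
    (h' : labels s = labels t) : s = t := by
  induction s generalizing t with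
  | nil =>
    cases t with
    | nil => rfl
    | node c t u => simp [labels] at h'
  | node c s s' ih ih' =>
    cases t with
    | nil => simp [labels] at h'
    | node d t t' =>
      simp only [shape, BinaryTree.map, BinaryTree.node.injEq, true_and] at h
      simp only [labels, List.cons.injEq] at h'
      obtain ⟨hs, hs'⟩ := List.append_inj h'.2 (length_labels_eq_of_shape_eq h.1)
      rw [h'.1, ih h.1 hs, ih' h.2 hs']

theorem exists_shape_eq_labels_eq (S : BinaryTree Unit) {l : List N} (h : l.length = S.numNodes) :
    ∃ t : BinaryTree N, shape t = S ∧ labels t = l := by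
  induction S generalizing l with
  | nil => exact ⟨.nil, rfl, (List.eq_nil_of_length_eq_zero h).symm⟩
  | node _ S T ihS ihT =>
    cases l with
    | nil => simp at h
    | cons c l =>
      simp only [BinaryTree.numNodes, List.length_cons] at h
      obtain ⟨s, hs, hs'⟩ := ihS (l := l.take S.numNodes) (by rw [List.length_take]; omega)
      obtain ⟨t, ht, ht'⟩ := ihT (l := l.drop S.numNodes) (by rw [List.length_drop]; omega)
      exact ⟨.node c s t, by simp [shape, BinaryTree.map, ← hs, ← ht], by simp [labels, hs', ht']⟩

theorem exists_equiv_tree_map_eq {s : BinaryTree N} {t : BinaryTree N'} (h : shape s = shape t)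
    (hs : IsEnumeration (labels s)) (ht : IsEnumeration (labels t)) :
    ∃ f : N ≃ N', s.map f = t := by
  obtain ⟨f, hf⟩ := hs.exists_equiv_map_eq ht (length_labels_eq_of_shape_eq h)
  exact ⟨f, eq_of_shape_eq_of_labels_eq ((shape_map f s).trans h) ((labels_map f s).trans hf)⟩

/-- The rotation of a labelled tree at the node `x` and its left child `y`: afterwards `y` is the
right child of `x`. -/
inductive LabelledRotation (x y : N) : BinaryTree N → BinaryTree N → Prop where
  | root (a b c : BinaryTree N) :
      LabelledRotation x y (.node x (.node y a b) c) (.node x a (.node y b c))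
  | left (z : N) (a a' b : BinaryTree N) (h : LabelledRotation x y a a') :
      LabelledRotation x y (.node z a b) (.node z a' b)
  | right (z : N) (a b b' : BinaryTree N) (h : LabelledRotation x y b b') :
      LabelledRotation x y (.node z a b) (.node z a b')

namespace LabelledRotation

variable {x y : N} {t t' : BinaryTree N}

theorem rightRotation (h : LabelledRotation x y t t') : RightRotation (shape t) (shape t') := by
  induction h with
  | root a b c => exact .root _ _ _
  | left _ a a' b _ ih => exact .left _ _ _ ih
  | right _ a b b' _ ih => exact .right _ _ _ ih

theorem labels_perm (h : LabelledRotation x y t t') : (labels t).Perm (labels t') := by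
  induction h with
  | root a b c =>
    simp only [labels, List.perm_cons, List.cons_append, List.append_assoc]
    exact List.perm_middle.symm
  | left z a a' b _ ih => exact (ih.append_right _).cons z
  | right z a b b' _ ih => exact (ih.append_left _).cons z

end LabelledRotation

theorem RightRotation.exists_labelledRotation {t : BinaryTree N} {S : BinaryTree Unit}
    (h : RightRotation (shape t) S) : ∃ x y t', shape t' = S ∧ LabelledRotation x y t t' := by
  generalize hs : shape t = T at h
  induction h generalizing t with
  | root A B C =>
    obtain _ | ⟨x, _ | ⟨y, a, b⟩, c⟩ := t <;>
      simp only [shape, BinaryTree.map, reduceCtorEq, BinaryTree.node.injEq, true_and,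
        false_and, and_false] at hs
    obtain ⟨⟨rfl, rfl⟩, rfl⟩ := hs
    exact ⟨x, y, _, rfl, .root a b c⟩
  | left A A' B _ ih =>
    obtain _ | ⟨z, a, b⟩ := t <;>
      simp only [shape, BinaryTree.map, reduceCtorEq, BinaryTree.node.injEq, true_and] at hs
    obtain ⟨rfl, rfl⟩ := hs
    obtain ⟨x, y, a', rfl, ha'⟩ := ih rfl
    exact ⟨x, y, _, rfl, .left z a a' b ha'⟩
  | right A B B' _ ih =>
    obtain _ | ⟨z, a, b⟩ := t <;>
      simp only [shape, BinaryTree.map, reduceCtorEq, BinaryTree.node.injEq, true_and] at hs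
    obtain ⟨rfl, rfl⟩ := hs
    obtain ⟨x, y, b', rfl, hb'⟩ := ih rfl
    exact ⟨x, y, _, rfl, .right z a b b' hb'⟩

end LabelledTrees

/-! ### Unfolding a binary structure into a tree -/

section Ports

variable {N Y X : Type}

/-- The ports of a labelled tree that lead to a node, in preorder; the tree is entered through the
port `y`, and the node `c` is left through the ports `l c` and `r c`. -/
def innerPorts (l r : N → Y) : Y → BinaryTree N → List Y
  | _, .nil => []
  | y, .node c s t => y :: (innerPorts l r (l c) s ++ innerPorts l r (r c) t)

/-- The ports of a labelled tree that lead to a leaf, from left to right. -/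
def leafPorts (l r : N → Y) : Y → BinaryTree N → List Y
  | y, .nil => [y]
  | _, .node c s t => leafPorts l r (l c) s ++ leafPorts l r (r c) t

/-- All the ports of a labelled tree, beginning with the port through which it is entered. -/
def allPorts (l r : N → Y) (y : Y) (t : BinaryTree N) : List Y :=
  y :: (labels t).flatMap fun c => [l c, r c]

/-- The relation `R` holds between every node of a labelled tree and the port that leads to it. -/
def ForallNodes (l r : N → Y) (R : Y → N → Prop) : Y → BinaryTree N → Prop
  | _, .nil => True
  | y, .node c s t => R y c ∧ ForallNodes l r R (l c) s ∧ ForallNodes l r R (r c) t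

/-- Suppose that the port `y` is joined to `f y` and that the node `c` is entered through `κ c`.
Starting from the port `y` one reads the labelled tree `t`. -/
def Unfolds (κ : N → X) (l r : N → Y) (f : Y → X) (y : Y) (t : BinaryTree N) : Prop :=
  ForallNodes l r (fun e c => f e = κ c) y t

/-- The node `d` is a child of the node `c`. -/
abbrev IsChild (κ : N → X) (l r : N → Y) (f : Y → X) (d c : N) : Prop :=
  f (l c) = κ d ∨ f (r c) = κ d

/-- The port `y` and the ports that leave the nodes are pairwise distinct. -/
structure DistinctPorts (l r : N → Y) (y : Y) : Prop where
  left_inj : Function.Injective l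
  right_inj : Function.Injective r
  left_ne_right : ∀ c d, l c ≠ r d
  root_ne_left : ∀ c, y ≠ l c
  root_ne_right : ∀ c, y ≠ r c

variable {κ : N → X} {l r : N → Y} {f f' : Y → X} {y y' : Y} {s t : BinaryTree N}
  {R R' : Y → N → Prop}

theorem length_innerPorts (y : Y) (t : BinaryTree N) :
    (innerPorts l r y t).length = (labels t).length := by
  induction t generalizing y with
  | nil => rfl
  | node c s t ihs iht => simp [innerPorts, labels, ihs, iht]

theorem length_leafPorts (y : Y) (t : BinaryTree N) :
    (leafPorts l r y t).length = t.numNodes + 1 := by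
  induction t generalizing y with
  | nil => rfl
  | node c s t ihs iht =>
    simp only [leafPorts, List.length_append, ihs, iht, BinaryTree.numNodes]
    omega

theorem allPorts_node_perm (y : Y) (c : N) (s t : BinaryTree N) :
    (allPorts l r y (.node c s t)).Perm
      (y :: (allPorts l r (l c) s ++ allPorts l r (r c) t)) := by
  simpa [allPorts, labels] using List.perm_middle.symm

theorem innerPorts_append_leafPorts_perm (y : Y) (t : BinaryTree N) :
    (innerPorts l r y t ++ leafPorts l r y t).Perm (allPorts l r y t) := by
  induction t generalizing y with
  | nil => exact .refl _
  | node c s t ihs iht =>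
    refine .trans ?_ (((ihs (l c)).append (iht (r c))).cons y |>.trans
      (allPorts_node_perm y c s t).symm)
    simp only [innerPorts, leafPorts, List.cons_append, List.append_assoc, List.perm_cons]
    refine .append_left _ ?_
    simp only [← List.append_assoc]
    exact List.perm_append_comm.append_right _

theorem mem_allPorts {e : Y} :
    e ∈ allPorts l r y t ↔ e = y ∨ ∃ c ∈ labels t, e = l c ∨ e = r c := by
  simp [allPorts]

theorem mem_allPorts_node {c : N} {e : Y} :
    e ∈ allPorts l r y (.node c s t) ↔
      e = y ∨ e ∈ allPorts l r (l c) s ∨ e ∈ allPorts l r (r c) t := by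
  rw [(allPorts_node_perm y c s t).mem_iff, List.mem_cons, List.mem_append]

theorem mem_allPorts_of_mem_leafPorts {e : Y} (h : e ∈ leafPorts l r y t) :
    e ∈ allPorts l r y t :=
  (innerPorts_append_leafPorts_perm y t).mem_iff.1 (List.mem_append_right _ h)

theorem mem_allPorts_of_mem_innerPorts {e : Y} (h : e ∈ innerPorts l r y t) :
    e ∈ allPorts l r y t :=
  (innerPorts_append_leafPorts_perm y t).mem_iff.1 (List.mem_append_left _ h)

theorem leafPorts_map {N' Y' : Type} {l' r' : N' → Y'} {g : N → N'} {ξ : Y → Y'}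
    (hl : ∀ c, l' (g c) = ξ (l c)) (hr : ∀ c, r' (g c) = ξ (r c)) (y : Y) (t : BinaryTree N) :
    leafPorts l' r' (ξ y) (t.map g) = (leafPorts l r y t).map ξ := by
  induction t generalizing y with
  | nil => rfl
  | node c s t ihs iht => simp only [leafPorts, BinaryTree.map, hl, hr, ihs, iht, List.map_append]

namespace ForallNodes

theorem imp (h : ForallNodes l r R y t)
    (hR : ∀ e ∈ innerPorts l r y t, ∀ c, R e c → R' e c) : ForallNodes l r R' y t := by
  induction t generalizing y with
  | nil => trivial
  | node c s t ihs iht =>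
    simp only [innerPorts, List.mem_cons, List.mem_append] at hR
    exact ⟨hR y (.inl rfl) c h.1, ihs h.2.1 fun e he => hR e (.inr (.inl he)),
      iht h.2.2 fun e he => hR e (.inr (.inr he))⟩

theorem and (h : ForallNodes l r R y t) (h' : ForallNodes l r R' y t) :
    ForallNodes l r (fun e c => R e c ∧ R' e c) y t := by
  induction t generalizing y with
  | nil => trivial
  | node c s t ihs iht => exact ⟨⟨h.1, h'.1⟩, ihs h.2.1 h'.2.1, iht h.2.2 h'.2.2⟩

theorem exists_of_mem_labels (h : ForallNodes l r R y t) {c : N} (hc : c ∈ labels t) :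
    ∃ e ∈ innerPorts l r y t, R e c := by
  induction t generalizing y with
  | nil => exact absurd hc List.not_mem_nil
  | node d s t ihs iht =>
    simp only [labels, List.mem_cons, List.mem_append] at hc
    simp only [innerPorts, List.mem_cons, List.mem_append]
    rcases hc with rfl | hc | hc
    · exact ⟨y, .inl rfl, h.1⟩
    · exact (ihs h.2.1 hc).imp fun e he => ⟨.inr (.inl he.1), he.2⟩
    · exact (iht h.2.2 hc).imp fun e he => ⟨.inr (.inr he.1), he.2⟩

end ForallNodes

theorem unfolds_iff_map_innerPorts_eq :
    Unfolds κ l r f y t ↔ (innerPorts l r y t).map f = (labels t).map κ := by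
  induction t generalizing y with
  | nil => exact ⟨fun _ => rfl, fun _ => trivial⟩
  | node c s t ihs iht =>
    have hlen : ((innerPorts l r (l c) s).map f).length = ((labels s).map κ).length := by
      simp [length_innerPorts]
    simp only [Unfolds, ForallNodes, innerPorts, labels, List.map_cons, List.map_append,
      List.cons.injEq] at ihs iht ⊢
    rw [ihs, iht, and_congr_right_iff]
    exact fun _ => ⟨fun h => by rw [h.1, h.2], fun h => List.append_inj h hlen⟩

namespace Unfolds

theorem map {N' Y' X' : Type} {κ' : N' → X'} {l' r' : N' → Y'} {f' : Y' → X'} {g : N → N'}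
    {ξ : Y → Y'} {η : X → X'} (h : Unfolds κ l r f y t) (hl : ∀ c, l' (g c) = ξ (l c))
    (hr : ∀ c, r' (g c) = ξ (r c)) (hκ : ∀ c, κ' (g c) = η (κ c)) (hf : ∀ e, f' (ξ e) = η (f e)) :
    Unfolds κ' l' r' f' (ξ y) (t.map g) := by
  induction t generalizing y with
  | nil => trivial
  | node c s t ihs iht =>
    refine ⟨(hf y).trans ((congrArg η h.1).trans (hκ c).symm), ?_, ?_⟩
    · rw [hl]
      exact ihs h.2.1
    · rw [hr]
      exact iht h.2.2

theorem exists_eq_node (h : Unfolds κ l r f y t) (hκ : Function.Injective κ)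
    (hleaf : ∀ e ∈ leafPorts l r y t, ∀ c, f e ≠ κ c) {c : N} (hc : f y = κ c) :
    ∃ s u, t = .node c s u := by
  cases t with
  | nil => exact absurd hc (hleaf y List.mem_cons_self c)
  | node d s u =>
    obtain rfl : d = c := hκ (h.1.symm.trans hc)
    exact ⟨s, u, rfl⟩

theorem eq_of_map_leafPorts_eq (h : Unfolds κ l r f y t) (h' : Unfolds κ l r f' y' t)
    (hleaf : (leafPorts l r y t).map f = (leafPorts l r y' t).map f') :
    f y = f' y' ∧ ∀ z ∈ labels t, f (l z) = f' (l z) ∧ f (r z) = f' (r z) := by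
  induction t generalizing y y' with
  | nil => simpa [leafPorts, labels] using hleaf
  | node c s t ihs iht =>
    simp only [leafPorts, List.map_append] at hleaf
    obtain ⟨hs, ht⟩ := List.append_inj hleaf (by simp only [List.length_map, length_leafPorts])
    obtain ⟨hl, hs⟩ := ihs h.2.1 h'.2.1 hs
    obtain ⟨hr, ht⟩ := iht h.2.2 h'.2.2 ht
    refine ⟨h.1.trans h'.1.symm, fun z hz => ?_⟩
    simp only [labels, List.mem_cons, List.mem_append] at hz
    rcases hz with rfl | hz | hz
    exacts [⟨hl, hr⟩, hs z hz, ht z hz]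

theorem acc_of_mem_labels (h : Unfolds κ l r f y t) (hκ : Function.Injective κ)
    (hleaf : ∀ e ∈ leafPorts l r y t, ∀ c, f e ≠ κ c) {c : N} (hc : c ∈ labels t) :
    Acc (IsChild κ l r f) c := by
  induction t generalizing y c with
  | nil => exact absurd hc List.not_mem_nil
  | node b s t ihs iht =>
    simp only [leafPorts, List.mem_append] at hleaf
    have hs := fun e he => hleaf e (.inl he)
    have ht := fun e he => hleaf e (.inr he)
    simp only [labels, List.mem_cons, List.mem_append] at hc
    rcases hc with rfl | hc | hc
    · refine ⟨_, fun d hd => ?_⟩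
      rcases hd with hd | hd
      · obtain ⟨_, _, rfl⟩ := exists_eq_node h.2.1 hκ hs hd
        exact ihs h.2.1 hs List.mem_cons_self
      · obtain ⟨_, _, rfl⟩ := exists_eq_node h.2.2 hκ ht hd
        exact iht h.2.2 ht List.mem_cons_self
    · exact ihs h.2.1 hs hc
    · exact iht h.2.2 ht hc

end Unfolds

theorem exists_unfolds (hw : WellFounded (IsChild κ l r f)) (y : Y) :
    ∃ t, Unfolds κ l r f y t ∧ ∀ e ∈ leafPorts l r y t, ∀ c, f e ≠ κ c := by
  have hleaf : ∀ e, (∀ c, f e ≠ κ c) →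
      ∃ t, Unfolds κ l r f e t ∧ ∀ z ∈ leafPorts l r e t, ∀ c, f z ≠ κ c :=
    fun e he => ⟨.nil, trivial, by simpa [leafPorts] using he⟩
  have hnode : ∀ c e, f e = κ c →
      ∃ t, Unfolds κ l r f e t ∧ ∀ z ∈ leafPorts l r e t, ∀ c, f z ≠ κ c := by
    intro c
    induction c using hw.induction with
    | _ c ih =>
      intro e he
      have hchild : ∀ z, (z = l c ∨ z = r c) →
          ∃ t, Unfolds κ l r f z t ∧ ∀ e ∈ leafPorts l r z t, ∀ c, f e ≠ κ c := by
        intro z hz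
        by_cases h : ∃ d, f z = κ d
        · obtain ⟨d, hd⟩ := h
          have hcd : IsChild κ l r f d c := by
            rcases hz with rfl | rfl
            exacts [.inl hd, .inr hd]
          exact ih d hcd z hd
        · exact hleaf z (not_exists.1 h)
      obtain ⟨s, hs, hs'⟩ := hchild _ (.inl rfl)
      obtain ⟨t, ht, ht'⟩ := hchild _ (.inr rfl)
      exact ⟨.node c s t, ⟨he, hs, ht⟩, fun z hz => (List.mem_append.1 hz).elim (hs' z) (ht' z)⟩
  by_cases h : ∃ c, f y = κ c
  · exact h.elim fun c hc => hnode c y hc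
  · exact hleaf y (not_exists.1 h)

namespace DistinctPorts

theorem nodup_allPorts (hD : DistinctPorts l r y) (ht : (labels t).Nodup) :
    (allPorts l r y t).Nodup := by
  refine List.nodup_cons.2 ⟨fun hy => ?_, List.nodup_flatMap.2 ⟨fun c _ => ?_, ?_⟩⟩
  · obtain ⟨c, -, hc⟩ := List.mem_flatMap.1 hy
    simp [hD.root_ne_left c, hD.root_ne_right c] at hc
  · simpa using hD.left_ne_right c c
  · refine ht.imp fun {c d} hcd => ?_
    simp [Function.onFun, hD.left_inj.ne hcd.symm, hD.right_inj.ne hcd.symm, hD.left_ne_right d c,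
      (hD.left_ne_right c d).symm]

theorem count_left [DecidableEq N] [DecidableEq Y] (hD : DistinctPorts l r y) (d : N) :
    (allPorts l r y t).count (l d) = (labels t).count d := by
  rw [allPorts, List.count_cons_of_ne (hD.root_ne_left d)]
  induction labels t with
  | nil => rfl
  | cons c L ih =>
    simp [List.count_cons, ih, (hD.left_ne_right d c).symm, hD.left_inj.eq_iff]

theorem count_right [DecidableEq N] [DecidableEq Y] (hD : DistinctPorts l r y) (d : N) :
    (allPorts l r y t).count (r d) = (labels t).count d := by
  rw [allPorts, List.count_cons_of_ne (hD.root_ne_right d)]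
  induction labels t with
  | nil => rfl
  | cons c L ih =>
    simp [List.count_cons, ih, hD.left_ne_right c d, hD.right_inj.eq_iff]

theorem count_root [DecidableEq Y] (hD : DistinctPorts l r y) : (allPorts l r y t).count y = 1 := by
  rw [allPorts, List.count_cons_self, List.count_eq_zero_of_not_mem]
  simp [hD.root_ne_left, hD.root_ne_right]

end DistinctPorts

namespace Unfolds

theorem count_labels [DecidableEq N] [DecidableEq Y] (h : Unfolds κ l r f y t)
    (hf : Function.Injective f) (hκ : Function.Injective κ)
    (hleaf : ∀ e ∈ leafPorts l r y t, ∀ c, f e ≠ κ c) {e : Y} {c : N} (he : f e = κ c) :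
    (labels t).count c = (allPorts l r y t).count e := by
  classical
  rw [← (innerPorts_append_leafPorts_perm y t).count_eq, List.count_append,
    List.count_eq_zero_of_not_mem fun hmem => hleaf e hmem c he, add_zero,
    ← List.count_map_of_injective _ f hf, unfolds_iff_map_innerPorts_eq.1 h, he,
    List.count_map_of_injective _ κ hκ]

theorem nodup_labels (h : Unfolds κ l r f y t) (hD : DistinctPorts l r y)
    (hf : Function.Injective f) (hκ : Function.Injective κ)
    (hleaf : ∀ e ∈ leafPorts l r y t, ∀ c, f e ≠ κ c)
    (hw : WellFounded (Function.swap (IsChild κ l r f))) : (labels t).Nodup := by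
  classical
  refine List.nodup_iff_count_le_one.2 fun c => ?_
  induction c using hw.induction with
  | _ c ih =>
    by_cases hc : c ∈ labels t
    · obtain ⟨e, he, hec⟩ := ForallNodes.exists_of_mem_labels h hc
      rw [h.count_labels hf hκ hleaf hec]
      rcases mem_allPorts.1 (mem_allPorts_of_mem_innerPorts he) with rfl | ⟨d, -, rfl | rfl⟩
      · exact hD.count_root.le
      · exact (hD.count_left d).trans_le (ih d (.inl hec))
      · exact (hD.count_right d).trans_le (ih d (.inr hec))
    · exact (List.count_eq_zero_of_not_mem hc).trans_le zero_le_one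

theorem mem_labels (h : Unfolds κ l r f y t) (hf : Function.Injective f)
    (hκ : Function.Injective κ) (hleaf : ∀ e ∈ leafPorts l r y t, ∀ c, f e ≠ κ c)
    (hw : WellFounded (Function.swap (IsChild κ l r f)))
    (hroot : ∀ c, f y = κ c ∨ ∃ d, IsChild κ l r f c d) (c : N) : c ∈ labels t := by
  classical
  have hmem : ∀ e ∈ allPorts l r y t, ∀ c, f e = κ c → c ∈ labels t := fun e he c hc =>
    List.count_pos_iff.1 (h.count_labels hf hκ hleaf hc ▸ List.count_pos_iff.2 he)
  induction c using hw.induction with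
  | _ c ih =>
    rcases hroot c with hc | ⟨d, hc⟩
    · exact hmem y (mem_allPorts.2 (.inl rfl)) c hc
    · exact hc.elim (hmem _ (mem_allPorts.2 (.inr ⟨d, ih d hc, .inl rfl⟩)) c)
        (hmem _ (mem_allPorts.2 (.inr ⟨d, ih d hc, .inr rfl⟩)) c)

theorem exists_innerPort (h : Unfolds κ l r f y t) (ht : IsEnumeration (labels t)) (c : N) :
    ∃ e ∈ innerPorts l r y t, f e = κ c :=
  ForallNodes.exists_of_mem_labels h (ht.mem c)

theorem ne_of_mem_leafPorts (h : Unfolds κ l r f y t) (ht : IsEnumeration (labels t))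
    (hD : DistinctPorts l r y) (hf : Function.Injective f) {e : Y} (he : e ∈ leafPorts l r y t)
    (c : N) : f e ≠ κ c := fun hc => by
  obtain ⟨e', he', hc'⟩ := h.exists_innerPort ht c
  have hnodup := (innerPorts_append_leafPorts_perm y t).nodup_iff.2 (hD.nodup_allPorts ht.nodup)
  exact List.disjoint_of_nodup_append hnodup he' (hf (hc'.trans hc.symm) ▸ he)

theorem eq_of_root_eq (h : Unfolds κ l r f y t) (h' : Unfolds κ l r f' y t)
    (ht : IsEnumeration (labels t)) (c : N) : ∃ e, f e = κ c ∧ f' e = κ c :=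
  (ForallNodes.and h h').exists_of_mem_labels (ht.mem c) |>.imp fun _ he => he.2

end Unfolds

/-! ### Rotations of unfolded trees -/

/-- The wiring `f'` arises from `f` by a rotation at the node `x` and its left child `y`. -/
structure RotatesAt (κ : N → X) (l r : N → Y) (f f' : Y → X) (x y : N) : Prop where
  child : f (l x) = κ y
  child' : f' (r x) = κ y
  left : f' (l x) = f (l y)
  mid : f' (l y) = f (r y)
  right : f' (r y) = f (r x)

theorem RotatesAt.eq {f'' : Y → X} {x z : N} (h : RotatesAt κ l r f f' x z)
    (h' : RotatesAt κ l r f f'' x z)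
    (hne : ∀ c, c ≠ x → c ≠ z → f' (l c) = f (l c) ∧ f' (r c) = f (r c))
    (hne' : ∀ c, c ≠ x → c ≠ z → f'' (l c) = f (l c) ∧ f'' (r c) = f (r c)) (c : N) :
    f' (l c) = f'' (l c) ∧ f' (r c) = f'' (r c) := by
  by_cases hx : c = x
  · exact ⟨by rw [hx, h.left, h'.left], by rw [hx, h.child', h'.child']⟩
  by_cases hz : c = z
  · exact ⟨by rw [hz, h.mid, h'.mid], by rw [hz, h.right, h'.right]⟩
  · exact ⟨by rw [(hne c hx hz).1, (hne' c hx hz).1], by rw [(hne c hx hz).2, (hne' c hx hz).2]⟩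

namespace Unfolds

theorem exists_labelledRotation (h : Unfolds κ l r f y t) (hκ : Function.Injective κ)
    (hleaf : ∀ e ∈ leafPorts l r y t, ∀ c, f e ≠ κ c) {x z : N} (hx : x ∈ labels t)
    (hxz : f (l x) = κ z) : ∃ t', LabelledRotation x z t t' := by
  induction t generalizing y with
  | nil => exact absurd hx List.not_mem_nil
  | node c s t ihs iht =>
    simp only [leafPorts, List.mem_append] at hleaf
    have hs := fun e he => hleaf e (.inl he)
    simp only [labels, List.mem_cons, List.mem_append] at hx
    rcases hx with rfl | hx | hx
    · obtain ⟨a, b, rfl⟩ := exists_eq_node h.2.1 hκ hs hxz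
      exact ⟨_, .root a b t⟩
    · exact (ihs h.2.1 hs hx).imp' (.node c · t) fun s' hs' => .left c s s' t hs'
    · exact (iht h.2.2 (fun e he => hleaf e (.inr he)) hx).imp' (.node c s ·)
        fun t' ht' => .right c s t t' ht'

theorem rotatesAt {x z : N} {t' : BinaryTree N} (hr : LabelledRotation x z t t')
    (h : Unfolds κ l r f y t) (h' : Unfolds κ l r f' y' t')
    (hleaf : (leafPorts l r y t).map f = (leafPorts l r y' t').map f') :
    f y = f' y' ∧ RotatesAt κ l r f f' x z ∧
      ∀ c ∈ labels t, c ≠ x → c ≠ z → f' (l c) = f (l c) ∧ f' (r c) = f (r c) := by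
  induction hr generalizing y y' with
  | root a b c =>
    simp only [leafPorts, List.map_append, List.append_assoc] at hleaf
    obtain ⟨hx, ⟨hz, ha, hb⟩, hc⟩ := h
    obtain ⟨hx', ha', hz', hb', hc'⟩ := h'
    obtain ⟨hla, hleaf⟩ := List.append_inj hleaf (by simp only [List.length_map, length_leafPorts])
    obtain ⟨hlb, hlc⟩ := List.append_inj hleaf (by simp only [List.length_map, length_leafPorts])
    have ea := eq_of_map_leafPorts_eq ha ha' hla
    have eb := eq_of_map_leafPorts_eq hb hb' hlb
    have ec := eq_of_map_leafPorts_eq hc hc' hlc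
    refine ⟨hx.trans hx'.symm, ⟨hz, hz', ea.1.symm, eb.1.symm, ec.1.symm⟩, fun d hd hdx hdz => ?_⟩
    simp only [labels, List.cons_append, List.mem_cons, hdx, hdz, List.mem_append, false_or] at hd
    rcases hd with (hd | hd) | hd
    exacts [(ea.2 d hd).imp .symm .symm, (eb.2 d hd).imp .symm .symm, (ec.2 d hd).imp .symm .symm]
  | left c a a' b hr ih =>
    simp only [leafPorts, List.map_append] at hleaf
    obtain ⟨hla, hlb⟩ := List.append_inj hleaf (by
      simp only [List.length_map, length_leafPorts, ← length_labels, hr.labels_perm.length_eq])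
    obtain ⟨ha, hrot, hne⟩ := ih h.2.1 h'.2.1 hla
    have hb := eq_of_map_leafPorts_eq h.2.2 h'.2.2 hlb
    refine ⟨h.1.trans h'.1.symm, hrot, fun d hd hdx hdz => ?_⟩
    simp only [labels, List.mem_cons, List.mem_append] at hd
    rcases hd with rfl | hd | hd
    exacts [⟨ha.symm, hb.1.symm⟩, hne d hd hdx hdz, (hb.2 d hd).imp .symm .symm]
  | right c a b b' _ ih =>
    simp only [leafPorts, List.map_append] at hleaf
    obtain ⟨hla, hlb⟩ := List.append_inj hleaf (by simp only [List.length_map, length_leafPorts])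
    obtain ⟨hb, hrot, hne⟩ := ih h.2.2 h'.2.2 hlb
    have ha := eq_of_map_leafPorts_eq h.2.1 h'.2.1 hla
    refine ⟨h.1.trans h'.1.symm, hrot, fun d hd hdx hdz => ?_⟩
    simp only [labels, List.mem_cons, List.mem_append] at hd
    rcases hd with rfl | hd | hd
    exacts [⟨ha.1.symm, hb.symm⟩, (ha.2 d hd).imp .symm .symm, hne d hd hdx hdz]

end Unfolds

/-! ### Contours of trees -/

/-- The values `U e` and `V e` on the two sides of the port `e`, which leads to the node `c`, agree
with those of the ports of `c` along the contour of the tree. -/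
structure IsContour (l r : N → Y) {F : Type} (U V : Y → F) (e : Y) (c : N) : Prop where
  right : U e = U (r c)
  left : V (l c) = V e
  mid : V (r c) = U (l c)

variable {F : Type} {U V : Y → F}

namespace ForallNodes

theorem map_leafPorts (h : ForallNodes l r (IsContour l r U V) y t) :
    (leafPorts l r y t).map V ++ [U y] = V y :: (leafPorts l r y t).map U := by
  induction t generalizing y with
  | nil => rfl
  | node c s t ihs iht =>
    rw [leafPorts, List.map_append, List.map_append, List.append_assoc, h.1.right, iht h.2.2,
      h.1.mid, List.append_cons, ihs h.2.1, h.1.left, List.cons_append]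

theorem mem_of_mem_allPorts {A : Set F} (h : ForallNodes l r (IsContour l r U V) y t)
    (hy : V y ∈ A) (hleaf : ∀ e ∈ leafPorts l r y t, U e ∈ A) :
    ∀ e ∈ allPorts l r y t, U e ∈ A ∧ V e ∈ A := by
  induction t generalizing y with
  | nil => simpa [allPorts, labels, hy] using hleaf y List.mem_cons_self
  | node c s t ihs iht =>
    simp only [leafPorts, List.mem_append] at hleaf
    have hs := ihs h.2.1 (h.1.left ▸ hy) fun e he => hleaf e (.inl he)
    have ht := iht h.2.2 (h.1.mid ▸ (hs _ List.mem_cons_self).1) fun e he => hleaf e (.inr he)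
    intro e he
    rcases mem_allPorts_node.1 he with rfl | he | he
    exacts [⟨h.1.right ▸ (ht _ List.mem_cons_self).1, hy⟩, hs e he, ht e he]

theorem isContour_congr {U' V' : Y → F} (h : ForallNodes l r (IsContour l r U V) y t)
    (hU : ∀ e ∈ allPorts l r y t, U' e = U e ∧ V' e = V e) :
    ForallNodes l r (IsContour l r U' V') y t := by
  induction t generalizing y with
  | nil => trivial
  | node c s t ihs iht =>
    have hy := hU y List.mem_cons_self
    have hl := hU (l c) (mem_allPorts_node.2 (.inr (.inl List.mem_cons_self)))
    have hr := hU (r c) (mem_allPorts_node.2 (.inr (.inr List.mem_cons_self)))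
    exact ⟨⟨by rw [hy.1, hr.1, h.1.right], by rw [hl.2, hy.2, h.1.left],
        by rw [hr.2, hl.1, h.1.mid]⟩,
      ihs h.2.1 fun e he => hU e (mem_allPorts_node.2 (.inr (.inl he))),
      iht h.2.2 fun e he => hU e (mem_allPorts_node.2 (.inr (.inr he)))⟩

end ForallNodes

theorem exists_contour (h : (allPorts l r y t).Nodup) {L : List F}
    (hL : L.length = t.numNodes + 2) :
    ∃ U V : Y → F, ForallNodes l r (IsContour l r U V) y t ∧
      V y :: (leafPorts l r y t).map U = L := by
  classical
  obtain ⟨a, L, rfl⟩ := List.exists_cons_of_length_eq_add_one hL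
  rw [List.length_cons, Nat.add_right_cancel_iff] at hL
  induction t generalizing y a L with
  | nil =>
    obtain ⟨b, rfl⟩ := List.length_eq_one_iff.1 hL
    exact ⟨fun _ => b, fun _ => a, trivial, rfl⟩
  | node c s t ihs iht =>
    rw [(allPorts_node_perm y c s t).nodup_iff, List.nodup_cons, List.mem_append, not_or,
      List.nodup_append] at h
    obtain ⟨⟨hys, hyt⟩, hs, ht, hst⟩ := h
    rw [BinaryTree.numNodes] at hL
    obtain ⟨U₁, V₁, h₁, hL₁⟩ := ihs hs a (L.take (s.numNodes + 1))
      (by rw [List.length_take]; omega)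
    obtain ⟨U₂, V₂, h₂, hL₂⟩ := iht ht (U₁ (l c)) (L.drop (s.numNodes + 1))
      (by rw [List.length_drop]; omega)
    obtain ⟨hV₁, hL₁⟩ := List.cons.inj hL₁
    obtain ⟨hV₂, hL₂⟩ := List.cons.inj hL₂
    let U e := if e ∈ allPorts l r (l c) s then U₁ e else
      if e ∈ allPorts l r (r c) t then U₂ e else U₂ (r c)
    let V e := if e ∈ allPorts l r (l c) s then V₁ e else
      if e ∈ allPorts l r (r c) t then V₂ e else a
    have heq₁ : ∀ e ∈ allPorts l r (l c) s, U e = U₁ e ∧ V e = V₁ e := fun e he => by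
      simp [U, V, he]
    have heq₂ : ∀ e ∈ allPorts l r (r c) t, U e = U₂ e ∧ V e = V₂ e := fun e he => by
      have he' : e ∉ allPorts l r (l c) s := fun he' => hst e he' e he rfl
      simp [U, V, he, he']
    have hl := heq₁ (l c) List.mem_cons_self
    have hr := heq₂ (r c) List.mem_cons_self
    refine ⟨U, V, ⟨⟨?_, ?_, ?_⟩, h₁.isContour_congr heq₁, h₂.isContour_congr heq₂⟩, ?_⟩
    · simp [U, hys, hyt, hr.1]
    · simp [V, hys, hyt, hl.2, hV₁]
    · rw [hr.2, hl.1, hV₂]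
    · rw [leafPorts, List.map_append,
        List.map_congr_left fun e he => (heq₁ e (mem_allPorts_of_mem_leafPorts he)).1,
        List.map_congr_left fun e he => (heq₂ e (mem_allPorts_of_mem_leafPorts he)).1,
        hL₁, hL₂, List.take_append_drop]
      simp [V, hys, hyt]

end Ports

/-! ### Gluing a tree of coproducts with a tree of products -/

/-- The outputs at the leaves of a tree of coproducts, from right to left. -/
abbrev copLeaves {C P : Type} (p₀ : P) (s : BinaryTree C) : List (OutPort C P) :=
  leafPorts OutPort.copR OutPort.copL (.prod p₀) s

/-- The inputs at the leaves of a tree of products, from left to right. -/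
abbrev prodLeaves {C P : Type} (c₀ : C) (t : BinaryTree P) : List (InPort C P) :=
  leafPorts InPort.prodL InPort.prodR (.cop c₀) t

/-- The wiring `w`, with closing edge from `p₀` to `c₀`, joins the coproducts into the mirror image
of the labelled tree `s`, and the products into the labelled tree `t`. -/
structure SplitsInto {C P : Type} (w : OutPort C P ≃ InPort C P) (p₀ : P) (c₀ : C)
    (s : BinaryTree C) (t : BinaryTree P) : Prop where
  closing : w (.prod p₀) = .cop c₀
  cop_labels : IsEnumeration (labels s)
  prod_labels : IsEnumeration (labels t)
  cop : Unfolds InPort.cop OutPort.copR OutPort.copL w (.prod p₀) s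
  prod : Unfolds OutPort.prod InPort.prodL InPort.prodR w.symm (.cop c₀) t

/-- The wiring `w`, with closing edge from `p₀` to `c₀`, is the gluing of the mirror image of the
labelled tree `s` with the labelled tree `t`. -/
structure Realizes {C P : Type} (w : OutPort C P ≃ InPort C P) (p₀ : P) (c₀ : C)
    (s : BinaryTree C) (t : BinaryTree P) : Prop extends SplitsInto w p₀ c₀ s t where
  glue : (copLeaves p₀ s).reverse.map w = prodLeaves c₀ t

section Realizes

variable {C P C' P' : Type} {w w' : OutPort C P ≃ InPort C P} {p₀ p₀' : P} {c₀ c₀' : C}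
  {s s' : BinaryTree C} {t t' : BinaryTree P}

theorem InPort.cop_injective : Function.Injective (InPort.cop : C → InPort C P) :=
  fun _ _ => InPort.cop.inj

theorem OutPort.prod_injective : Function.Injective (OutPort.prod : P → OutPort C P) :=
  fun _ _ => OutPort.prod.inj

theorem distinctPorts_cop (p₀ : P) :
    DistinctPorts (OutPort.copR : C → OutPort C P) OutPort.copL (.prod p₀) where
  left_inj _ _ := OutPort.copR.inj
  right_inj _ _ := OutPort.copL.inj
  left_ne_right _ _ := nofun
  root_ne_left _ := nofun
  root_ne_right _ := nofun

theorem distinctPorts_prod (c₀ : C) :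
    DistinctPorts (InPort.prodL : P → InPort C P) InPort.prodR (.cop c₀) where
  left_inj _ _ := InPort.prodL.inj
  right_inj _ _ := InPort.prodR.inj
  left_ne_right _ _ := nofun
  root_ne_left _ := nofun
  root_ne_right _ := nofun

namespace SplitsInto

theorem closing_symm (h : SplitsInto w p₀ c₀ s t) : w.symm (.cop c₀) = .prod p₀ :=
  w.symm_apply_eq.2 h.closing.symm

theorem exists_cop_eq_node (h : SplitsInto w p₀ c₀ s t) : ∃ a b, s = .node c₀ a b := by
  cases s with
  | nil => exact absurd (h.cop_labels.mem c₀) List.not_mem_nil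
  | node c a b =>
    obtain rfl : c₀ = c := InPort.cop.inj (h.closing.symm.trans h.cop.1)
    exact ⟨a, b, rfl⟩

theorem exists_prod_eq_node (h : SplitsInto w p₀ c₀ s t) : ∃ a b, t = .node p₀ a b := by
  cases t with
  | nil => exact absurd (h.prod_labels.mem p₀) List.not_mem_nil
  | node p a b =>
    obtain rfl : p₀ = p := OutPort.prod.inj (h.closing_symm.symm.trans h.prod.1)
    exact ⟨a, b, rfl⟩

theorem south_eq (h : SplitsInto w p₀ c₀ s t) (h' : SplitsInto w' p₀' c₀' s t') : c₀ = c₀' := by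
  obtain ⟨a, b, rfl⟩ := h.exists_cop_eq_node
  obtain ⟨a', b', hs⟩ := h'.exists_cop_eq_node
  exact (BinaryTree.node.inj hs).1

theorem north_eq (h : SplitsInto w p₀ c₀ s t) (h' : SplitsInto w' p₀' c₀' s' t) : p₀ = p₀' := by
  obtain ⟨a, b, rfl⟩ := h.exists_prod_eq_node
  obtain ⟨a', b', ht⟩ := h'.exists_prod_eq_node
  exact (BinaryTree.node.inj ht).1

theorem copLeaves_eq (h : SplitsInto w p₀ c₀ s t) (p : P) : copLeaves p s = copLeaves p₀ s := by
  obtain ⟨a, b, rfl⟩ := h.exists_cop_eq_node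
  rfl

theorem prodLeaves_eq (h : SplitsInto w p₀ c₀ s t) (c : C) :
    prodLeaves c t = prodLeaves c₀ t := by
  obtain ⟨a, b, rfl⟩ := h.exists_prod_eq_node
  rfl

theorem wire_ne_cop (h : SplitsInto w p₀ c₀ s t) {e : OutPort C P} (he : e ∈ copLeaves p₀ s)
    (c : C) : w e ≠ .cop c :=
  h.cop.ne_of_mem_leafPorts h.cop_labels (distinctPorts_cop p₀) w.injective he c

theorem wire_symm_ne_prod (h : SplitsInto w p₀ c₀ s t) {i : InPort C P}
    (hi : i ∈ prodLeaves c₀ t) (p : P) : w.symm i ≠ .prod p :=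
  h.prod.ne_of_mem_leafPorts h.prod_labels (distinctPorts_prod c₀) w.symm.injective hi p

theorem eq_of_wire_prod_eq_cop (h : SplitsInto w p₀ c₀ s t) {p : P} {c : C}
    (hpc : w (.prod p) = .cop c) : p = p₀ := by
  obtain ⟨e, he, hec⟩ := h.cop.exists_innerPort h.cop_labels c
  obtain rfl : e = .prod p := w.injective (hec.trans hpc.symm)
  simpa [allPorts] using mem_allPorts_of_mem_innerPorts he

theorem wire_prod_eq (h : SplitsInto w p₀ c₀ s t) (h' : SplitsInto w' p₀' c₀ s' t) (p : P) :
    w (.prod p) = w' (.prod p) := by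
  obtain ⟨e, he, he'⟩ := h.prod.eq_of_root_eq h'.prod h.prod_labels p
  exact ((w.symm_apply_eq.1 he).symm.trans (w'.symm_apply_eq.1 he'))

theorem wire_symm_cop_eq (h : SplitsInto w p₀ c₀ s t) (h' : SplitsInto w' p₀ c₀' s t') (c : C) :
    w.symm (.cop c) = w'.symm (.cop c) := by
  obtain ⟨e, he, he'⟩ := h.cop.eq_of_root_eq h'.cop h.cop_labels c
  rw [← he, w.symm_apply_apply, he, ← he', w'.symm_apply_apply]

end SplitsInto

theorem equiv_eq_of_ports_eq (hL : ∀ c, w (.copL c) = w' (.copL c))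
    (hR : ∀ c, w (.copR c) = w' (.copR c)) (hp : ∀ p, w (.prod p) = w' (.prod p)) : w = w' := by
  ext o
  cases o with
  | copL c => exact hL c
  | copR c => exact hR c
  | prod p => exact hp p

theorem Realizes.unique (h : Realizes w p₀ c₀ s t) (h' : Realizes w' p₀' c₀' s t) :
    p₀ = p₀' ∧ c₀ = c₀' ∧ w = w' := by
  obtain rfl := h.north_eq h'.toSplitsInto
  obtain rfl := h.south_eq h'.toSplitsInto
  have hleaf : (copLeaves p₀ s).map w = (copLeaves p₀ s).map w' := by
    rw [← List.reverse_inj, ← List.map_reverse, ← List.map_reverse, h.glue, h'.glue]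
  have hcop := (h.cop.eq_of_map_leafPorts_eq h'.cop hleaf).2
  exact ⟨rfl, rfl, equiv_eq_of_ports_eq (fun c => (hcop c (h.cop_labels.mem c)).2)
    (fun c => (hcop c (h.cop_labels.mem c)).1) (h.wire_prod_eq h'.toSplitsInto)⟩

theorem Realizes.map (h : Realizes w p₀ c₀ s t) (f : C ≃ C') (g : P ≃ P')
    {u : OutPort C' P' ≃ InPort C' P'} (hu : ∀ o, u (o.map f g) = (w o).map f g) :
    Realizes u (g p₀) (f c₀) (s.map f) (t.map g) where
  closing := (hu (.prod p₀)).trans (congrArg (InPort.map f g) h.closing)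
  cop_labels := labels_map f s ▸ h.cop_labels.map f
  prod_labels := labels_map g t ▸ h.prod_labels.map g
  cop := h.cop.map (ξ := OutPort.map f g) (fun _ => rfl) (fun _ => rfl) (fun _ => rfl) hu
  prod := h.prod.map (ξ := InPort.map f g) (η := OutPort.map f g) (fun _ => rfl) (fun _ => rfl)
    (fun _ => rfl) fun i => by rw [Equiv.symm_apply_eq, hu, Equiv.apply_symm_apply]
  glue := by
    have hcop : copLeaves (g p₀) (s.map f) = (copLeaves p₀ s).map (OutPort.map f g) :=
      leafPorts_map (ξ := OutPort.map f g) (fun _ => by rfl) (fun _ => by rfl) (.prod p₀) s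
    have hprod : prodLeaves (f c₀) (t.map g) = (prodLeaves c₀ t).map (InPort.map f g) :=
      leafPorts_map (ξ := InPort.map f g) (fun _ => by rfl) (fun _ => by rfl) (.cop c₀) t
    rw [hcop, hprod, ← h.glue, ← List.map_reverse, List.map_map, List.map_map]
    exact List.map_congr_left fun o _ => hu o

/-- Renaming the operators, as a bijection of the outputs. -/
def OutPort.mapEquiv (f : C ≃ C') (g : P ≃ P') : OutPort C P ≃ OutPort C' P' where
  toFun := OutPort.map f g
  invFun := OutPort.map f.symm g.symm
  left_inv o := by cases o <;> simp [OutPort.map]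
  right_inv o := by cases o <;> simp [OutPort.map]

/-- Renaming the operators, as a bijection of the inputs. -/
def InPort.mapEquiv (f : C ≃ C') (g : P ≃ P') : InPort C P ≃ InPort C' P' where
  toFun := InPort.map f g
  invFun := InPort.map f.symm g.symm
  left_inv i := by cases i <;> simp [InPort.map]
  right_inv i := by cases i <;> simp [InPort.map]

end Realizes

namespace LabelledPrograph

variable {C P C' P' : Type} {G : LabelledPrograph C P} {H : LabelledPrograph C' P'}
  {s : BinaryTree C} {t : BinaryTree P}

/-- The prograph is the gluing of the mirror image of the labelled tree `s`, formed by the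
coproducts, with the labelled tree `t`, formed by the products. -/
def RealizedBy (G : LabelledPrograph C P) (s : BinaryTree C) (t : BinaryTree P) : Prop :=
  Realizes G.wire G.north G.south s t

theorem Iso.map_south {f : C ≃ C'} {g : P ≃ P'} (hg : g G.north = H.north)
    (h : ∀ o : OutPort C P, H.wire (o.map f g) = (G.wire o).map f g) : f G.south = H.south := by
  have hn := h (.prod G.north)
  rw [G.closing, OutPort.map, hg, H.closing] at hn
  exact (InPort.cop.inj hn).symm

namespace RealizedBy

theorem exists_of_iso (h : G.RealizedBy s t) (hi : G.Iso H) :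
    ∃ s' t', H.RealizedBy s' t' ∧ shape s' = shape s ∧ shape t' = shape t := by
  obtain ⟨f, g, hg, hw⟩ := hi
  have hmap := Realizes.map h f g hw
  rw [hg, Iso.map_south hg hw] at hmap
  exact ⟨_, _, hmap, shape_map _ _, shape_map _ _⟩

theorem iso (h : G.RealizedBy s t) {s' : BinaryTree C'} {t' : BinaryTree P'}
    (h' : H.RealizedBy s' t') (hs : shape s = shape s') (ht : shape t = shape t') : G.Iso H := by
  obtain ⟨f, rfl⟩ := exists_equiv_tree_map_eq hs h.cop_labels h'.cop_labels
  obtain ⟨g, rfl⟩ := exists_equiv_tree_map_eq ht h.prod_labels h'.prod_labels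
  let u := (OutPort.mapEquiv f g).symm.trans (G.wire.trans (InPort.mapEquiv f g))
  have hu : ∀ o, u (o.map f g) = (G.wire o).map f g := fun o =>
    congrArg (fun o => (G.wire o).map f g) ((OutPort.mapEquiv f g).symm_apply_apply o)
  obtain ⟨hn, -, hw⟩ := (Realizes.map h f g hu).unique h'
  exact ⟨f, g, hn, fun o => by rw [← hu, hw]⟩

theorem not_hasProdCopEdge (h : G.RealizedBy s t) : ¬ G.HasProdCopEdge :=
  fun ⟨_, _, hp, hc⟩ => hp (h.eq_of_wire_prod_eq_cop hc)

end RealizedBy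

end LabelledPrograph

/-! ### Faces of a gluing -/

section Faces

variable {C P : Type} {w : OutPort C P ≃ InPort C P} {p₀ : P} {c₀ : C} {s : BinaryTree C}
  {t : BinaryTree P} {F : Type}

/-- The face that contains a half-edge, in the numbering of the faces by orbits of half-edges. -/
def faceOf (w : OutPort C P ≃ InPort C P) (x : Dart C P) : Faces w :=
  Quotient.mk (Equiv.Perm.SameCycle.setoid ((edgeFlip w).trans (dartRotation C P))) x

/-- The face to the left of an edge, seen in the direction of the edge. -/
def leftFace (w : OutPort C P ≃ InPort C P) (o : OutPort C P) : Faces w := faceOf w (.inr (w o))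

/-- The face to the right of an edge, seen in the direction of the edge. -/
def rightFace (w : OutPort C P ≃ InPort C P) (o : OutPort C P) : Faces w := faceOf w (.inl o)

theorem faceOf_step (w : OutPort C P ≃ InPort C P) (x : Dart C P) :
    faceOf w (dartRotation C P (edgeFlip w x)) = faceOf w x :=
  Quotient.sound (s := Equiv.Perm.SameCycle.setoid ((edgeFlip w).trans (dartRotation C P)))
    (Equiv.Perm.sameCycle_apply_left.2 (Equiv.Perm.SameCycle.refl _ _))

theorem exists_leftFace_eq_or_rightFace_eq (φ : Faces w) :
    ∃ o, leftFace w o = φ ∨ rightFace w o = φ := by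
  obtain ⟨o | i, rfl⟩ : ∃ x, faceOf w x = φ := Quotient.exists_rep φ
  · exact ⟨o, .inr rfl⟩
  · exact ⟨w.symm i, .inl (by rw [leftFace, w.apply_symm_apply])⟩

theorem isContour_cop {o : OutPort C P} {c : C} (h : w o = .cop c) :
    IsContour OutPort.copR OutPort.copL (leftFace w) (rightFace w) o c where
  right := by
    simpa [leftFace, edgeFlip, dartRotation, h] using faceOf_step w (.inr (w (.copL c)))
  left := by simpa [rightFace, edgeFlip, dartRotation, h] using faceOf_step w (.inl o)
  mid := by
    simpa [leftFace, rightFace, edgeFlip, dartRotation] using faceOf_step w (.inr (w (.copR c)))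

theorem isContour_prod {i : InPort C P} {p : P} (h : w.symm i = .prod p) :
    IsContour InPort.prodL InPort.prodR (fun i => rightFace w (w.symm i))
      (fun i => leftFace w (w.symm i)) i p where
  right := by
    simpa [rightFace, edgeFlip, dartRotation, h] using faceOf_step w (.inl (w.symm (.prodR p)))
  left := by
    obtain rfl := w.symm_apply_eq.1 h
    simpa [leftFace, edgeFlip, dartRotation] using faceOf_step w (.inr (w (.prod p)))
  mid := by
    simpa [leftFace, rightFace, edgeFlip, dartRotation] using
      faceOf_step w (.inl (w.symm (.prodL p)))

theorem eq_of_faceOf_eq {f : Dart C P → F} (hf : ∀ x, f (dartRotation C P (edgeFlip w x)) = f x)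
    {x y : Dart C P} (h : faceOf w x = faceOf w y) : f x = f y := by
  obtain ⟨k, rfl⟩ : Equiv.Perm.SameCycle ((edgeFlip w).trans (dartRotation C P)) x y :=
    Quotient.exact h
  clear h
  set σ : Equiv.Perm (Dart C P) := (edgeFlip w).trans (dartRotation C P)
  have hσ : ∀ z, f (σ z) = f z := hf
  induction k generalizing x with
  | zero => rfl
  | succ k ih => rw [zpow_add_one, Equiv.Perm.mul_apply, ← ih, hσ]
  | pred k ih =>
    rw [zpow_sub_one, Equiv.Perm.mul_apply, ← ih]
    simpa using hσ (σ⁻¹ x)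

theorem exists_lift_of_isContour {U V : OutPort C P → F}
    (hcop : ∀ o c, w o = .cop c → IsContour OutPort.copR OutPort.copL U V o c)
    (hprod : ∀ i p, w.symm i = .prod p →
      IsContour InPort.prodL InPort.prodR (fun i => V (w.symm i)) (fun i => U (w.symm i)) i p) :
    ∃ g : Faces w → F, ∀ o, g (leftFace w o) = U o ∧ g (rightFace w o) = V o := by
  let f : Dart C P → F := Sum.elim V fun i => U (w.symm i)
  have hf : ∀ x, f (dartRotation C P (edgeFlip w x)) = f x := by
    rintro (o | i)
    · cases h : w o with
      | cop c => simpa [f, edgeFlip, dartRotation, h] using (hcop o c h).left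
      | prodL p =>
        obtain rfl := w.eq_symm_apply.2 h
        simpa [f, edgeFlip, dartRotation] using
          (hprod _ p (w.symm_apply_apply (.prod p))).mid
      | prodR p =>
        obtain rfl := w.eq_symm_apply.2 h
        simpa [f, edgeFlip, dartRotation] using
          (hprod _ p (w.symm_apply_apply (.prod p))).right
    · cases h : w.symm i with
      | prod p => simpa [f, edgeFlip, dartRotation, h] using (hprod i p h).left
      | copL c => simpa [f, edgeFlip, dartRotation, h] using
          (hcop _ c (w.apply_symm_apply (.cop c))).right
      | copR c => simpa [f, edgeFlip, dartRotation, h] using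
          (hcop _ c (w.apply_symm_apply (.cop c))).mid
  refine ⟨Quotient.lift f fun x y h => eq_of_faceOf_eq hf (Quotient.sound h), fun o => ⟨?_, rfl⟩⟩
  exact congrArg U (w.symm_apply_apply o)

/-- The faces in the gaps between the leaves of the tree of products, from left to right, the two
sides of the tree included. -/
def gapFaces (w : OutPort C P ≃ InPort C P) (c₀ : C) (t : BinaryTree P) : List (Faces w) :=
  leftFace w (w.symm (.cop c₀)) :: (prodLeaves c₀ t).map fun i => rightFace w (w.symm i)

theorem length_gapFaces : (gapFaces w c₀ t).length = t.numNodes + 2 := by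
  rw [gapFaces, List.length_cons, List.length_map, length_leafPorts]

namespace SplitsInto

theorem mem_allPorts_cop (h : SplitsInto w p₀ c₀ s t) {o : OutPort C P} :
    o ∈ allPorts OutPort.copR OutPort.copL (.prod p₀) s ↔ ∀ p, o = .prod p → p = p₀ := by
  cases o with
  | copL c => simpa [allPorts] using h.cop_labels.mem c
  | copR c => simpa [allPorts] using h.cop_labels.mem c
  | prod p => simp [allPorts]

theorem mem_allPorts_prod (h : SplitsInto w p₀ c₀ s t) {i : InPort C P} :
    i ∈ allPorts InPort.prodL InPort.prodR (.cop c₀) t ↔ ∀ c, i = .cop c → c = c₀ := by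
  cases i with
  | prodL p => simpa [allPorts] using h.prod_labels.mem p
  | prodR p => simpa [allPorts] using h.prod_labels.mem p
  | cop c => simp [allPorts]

theorem mem_allPorts_cop_or_mem_allPorts_prod (h : SplitsInto w p₀ c₀ s t) (o : OutPort C P) :
    o ∈ allPorts OutPort.copR OutPort.copL (.prod p₀) s ∨
      w o ∈ allPorts InPort.prodL InPort.prodR (.cop c₀) t := by
  rw [h.mem_allPorts_cop, h.mem_allPorts_prod, or_iff_not_imp_left]
  push Not
  rintro ⟨p, rfl, hp⟩ c hc
  exact absurd (h.eq_of_wire_prod_eq_cop hc) hp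

theorem mem_prodLeaves_of_wire_symm_ne_prod (h : SplitsInto w p₀ c₀ s t) {i : InPort C P}
    (hi : i ∈ allPorts InPort.prodL InPort.prodR (.cop c₀) t) (hne : ∀ p, w.symm i ≠ .prod p) :
    i ∈ prodLeaves c₀ t := by
  rw [← (innerPorts_append_leafPorts_perm _ t).mem_iff, List.mem_append] at hi
  refine hi.resolve_left fun hinner => ?_
  have hmap := List.mem_map_of_mem (f := w.symm) hinner
  rw [unfolds_iff_map_innerPorts_eq.1 h.prod] at hmap
  obtain ⟨p, -, hp⟩ := List.mem_map.1 hmap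
  exact hne p hp.symm

theorem wire_mem_prodLeaves (h : SplitsInto w p₀ c₀ s t) {o : OutPort C P}
    (ho : o ∈ copLeaves p₀ s) : w o ∈ prodLeaves c₀ t := by
  refine h.mem_prodLeaves_of_wire_symm_ne_prod
    (h.mem_allPorts_prod.2 fun c hc => absurd hc (h.wire_ne_cop ho c)) fun p hp => ?_
  rw [w.symm_apply_apply] at hp
  obtain rfl := h.mem_allPorts_cop.1 (mem_allPorts_of_mem_leafPorts ho) p hp
  exact h.wire_ne_cop ho c₀ (hp ▸ h.closing)

theorem eq_or_mem_prodLeaves (h : SplitsInto w p₀ c₀ s t) {i : InPort C P}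
    (hi : i ∈ allPorts InPort.prodL InPort.prodR (.cop c₀) t)
    (hi' : w.symm i ∈ allPorts OutPort.copR OutPort.copL (.prod p₀) s) :
    i = .cop c₀ ∨ i ∈ prodLeaves c₀ t := by
  refine or_iff_not_imp_left.2 fun hne => h.mem_prodLeaves_of_wire_symm_ne_prod hi fun p hp => ?_
  obtain rfl := h.mem_allPorts_cop.1 hi' p hp
  exact hne ((w.symm_apply_eq.1 hp).trans h.closing)

theorem forallNodes_cop (h : SplitsInto w p₀ c₀ s t) {R : OutPort C P → C → Prop} :
    ForallNodes OutPort.copR OutPort.copL R (.prod p₀) s ↔ ∀ o c, w o = .cop c → R o c := by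
  refine ⟨fun hR o c ho => ?_, fun hR => ForallNodes.imp h.cop fun o _ c => hR o c⟩
  obtain ⟨e, -, he, hRe⟩ := (ForallNodes.and h.cop hR).exists_of_mem_labels (h.cop_labels.mem c)
  rwa [← w.injective (he.trans ho.symm)]

theorem forallNodes_prod (h : SplitsInto w p₀ c₀ s t) {R : InPort C P → P → Prop} :
    ForallNodes InPort.prodL InPort.prodR R (.cop c₀) t ↔
      ∀ i p, w.symm i = .prod p → R i p := by
  refine ⟨fun hR i p hi => ?_, fun hR => ForallNodes.imp h.prod fun i _ p => hR i p⟩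
  obtain ⟨e, -, he, hRe⟩ := (ForallNodes.and h.prod hR).exists_of_mem_labels (h.prod_labels.mem p)
  rwa [← w.symm.injective (he.trans hi.symm)]

theorem mem_gapFaces (h : SplitsInto w p₀ c₀ s t) (φ : Faces w) : φ ∈ gapFaces w c₀ t := by
  have hprod : ∀ i ∈ allPorts InPort.prodL InPort.prodR (.cop c₀) t,
      rightFace w (w.symm i) ∈ gapFaces w c₀ t ∧ leftFace w (w.symm i) ∈ gapFaces w c₀ t :=
    (h.forallNodes_prod.2 fun _ _ => isContour_prod).mem_of_mem_allPorts
      (A := {φ | φ ∈ gapFaces w c₀ t}) List.mem_cons_self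
      fun i hi => List.mem_cons_of_mem _ (List.mem_map_of_mem hi)
  have hcop : ∀ o ∈ allPorts OutPort.copR OutPort.copL (.prod p₀) s,
      leftFace w o ∈ gapFaces w c₀ t ∧ rightFace w o ∈ gapFaces w c₀ t := by
    refine (h.forallNodes_cop.2 fun _ _ => isContour_cop).mem_of_mem_allPorts
      (A := {φ | φ ∈ gapFaces w c₀ t}) ?_ fun o ho => ?_
    · exact h.closing_symm ▸ (hprod _ List.mem_cons_self).1
    · rw [← w.symm_apply_apply o]
      exact (hprod _ (mem_allPorts_of_mem_leafPorts (h.wire_mem_prodLeaves ho))).2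
  have hall : ∀ o, leftFace w o ∈ gapFaces w c₀ t ∧ rightFace w o ∈ gapFaces w c₀ t := by
    refine fun o => (h.mem_allPorts_cop_or_mem_allPorts_prod o).elim (hcop o) fun ho => ?_
    exact (w.symm_apply_apply o ▸ hprod _ ho).symm
  obtain ⟨o, rfl | rfl⟩ := exists_leftFace_eq_or_rightFace_eq φ
  exacts [(hall o).1, (hall o).2]

end SplitsInto

/-- Two lists agree if each lists the orbit of `a` under the successor map `x ↦ V⁻¹ (U x)`. -/
theorem eq_of_map_append_eq_cons {A : Type} {U V : A → F} {K M : List A} {D : Set A} {a b : F}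
    (hV : Set.InjOn V D) (hK : ∀ x ∈ K, x ∈ D) (hM : ∀ x ∈ M, x ∈ D) (hl : K.length = M.length)
    (eK : K.map V ++ [b] = a :: K.map U) (eM : M.map V ++ [b] = a :: M.map U) : K = M := by
  induction K generalizing M a with
  | nil => exact (List.eq_nil_of_length_eq_zero hl.symm).symm
  | cons k K ih =>
    cases M with
    | nil => simp at hl
    | cons m M =>
      simp only [List.map_cons, List.cons_append, List.cons.injEq] at eK eM
      simp only [List.mem_cons, forall_eq_or_imp] at hK hM
      obtain rfl : k = m := hV hK.1 hM.1 (eK.1.trans eM.1.symm)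
      rw [ih hK.2 hM.2 (Nat.succ.inj hl) eK.2 eM.2]

theorem SplitsInto.realizes (h : SplitsInto w p₀ c₀ s t) (hst : s.numNodes = t.numNodes)
    (hF : Nat.card (Faces w) = t.numNodes + 2) : Realizes w p₀ c₀ s t := by
  have hprod := (h.forallNodes_prod.2 fun _ _ => isContour_prod).map_leafPorts
  have hcop := (h.forallNodes_cop.2 fun _ _ => isContour_cop).map_leafPorts
  have hgaps : (gapFaces w c₀ t).Nodup :=
    (IsEnumeration.of_mem_of_length_eq h.mem_gapFaces (length_gapFaces.trans hF.symm)).nodup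
  have hinj : Set.InjOn (fun i => leftFace w (w.symm i)) {i | i ∈ prodLeaves c₀ t} := by
    rw [gapFaces, ← hprod] at hgaps
    exact fun i hi j hj => List.inj_on_of_nodup_map (List.nodup_append.1 hgaps).1 hi hj
  refine ⟨h, eq_of_map_append_eq_cons hinj (fun i hi => ?_) (fun i hi => hi) ?_ ?_ hprod⟩
  · obtain ⟨o, ho, rfl⟩ := List.mem_map.1 hi
    exact h.wire_mem_prodLeaves (List.mem_reverse.1 ho)
  · simp [length_leafPorts, hst]
  · simpa [h.closing_symm, Function.comp_def] using (congrArg List.reverse hcop).symm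

namespace Realizes

theorem numNodes_eq (h : Realizes w p₀ c₀ s t) : s.numNodes = t.numNodes := by
  simpa [length_leafPorts] using congrArg List.length h.glue

theorem mem_copLeaves_of_wire_mem (h : Realizes w p₀ c₀ s t) {o : OutPort C P}
    (ho : w o ∈ prodLeaves c₀ t) : o ∈ copLeaves p₀ s := by
  rw [← h.glue] at ho
  exact List.mem_reverse.1 ((List.mem_map_of_injective w.injective).1 ho)

theorem exists_compatible_contours (h : Realizes w p₀ c₀ s t) {L : List F}
    (hL : L.length = t.numNodes + 2) :
    ∃ (U V : OutPort C P → F) (U' V' : InPort C P → F),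
      ForallNodes OutPort.copR OutPort.copL (IsContour OutPort.copR OutPort.copL U V) (.prod p₀) s ∧
      ForallNodes InPort.prodL InPort.prodR (IsContour InPort.prodL InPort.prodR V' U')
        (.cop c₀) t ∧
      U' (.cop c₀) :: (prodLeaves c₀ t).map V' = L ∧
      ∀ o, o = .prod p₀ ∨ o ∈ copLeaves p₀ s → U o = U' (w o) ∧ V o = V' (w o) := by
  obtain ⟨V', U', hprod, hL'⟩ :=
    exists_contour ((distinctPorts_prod c₀).nodup_allPorts h.prod_labels.nodup) hL
  obtain ⟨U, V, hcop, hLr⟩ :=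
    exists_contour ((distinctPorts_cop p₀).nodup_allPorts h.cop_labels.nodup)
      (L := L.reverse) (by rw [List.length_reverse, hL, h.numNodes_eq])
  have hend := hprod.map_leafPorts.trans hL'
  have hleft := hLr.trans (congrArg List.reverse hend.symm)
  have hright := (hcop.map_leafPorts.trans hLr).trans (congrArg List.reverse hL'.symm)
  simp only [← h.glue, List.map_reverse, List.map_map, List.reverse_append, List.reverse_cons,
    List.reverse_reverse, List.reverse_nil, List.nil_append, List.cons_append] at hleft hright
  obtain ⟨hVroot, hUleaf⟩ := List.cons.inj hleft
  obtain ⟨hVleaf, hUroot⟩ := List.append_inj' hright rfl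
  refine ⟨U, V, U', V', hcop, hprod, hL', ?_⟩
  rintro o (rfl | ho)
  · rw [h.closing]
    exact ⟨(List.cons.inj hUroot).1, hVroot⟩
  · exact ⟨List.map_inj_left.1 hUleaf o ho, List.map_inj_left.1 hVleaf o ho⟩

theorem exists_gap_numbering (h : Realizes w p₀ c₀ s t) {L : List F}
    (hL : L.length = t.numNodes + 2) :
    ∃ g : Faces w → F, (gapFaces w c₀ t).map g = L := by
  classical
  obtain ⟨U, V, U', V', hcop, hprod, rfl, hUV⟩ := h.exists_compatible_contours hL
  have hcomm : ∀ o ∈ allPorts OutPort.copR OutPort.copL (.prod p₀) s,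
      w o ∈ allPorts InPort.prodL InPort.prodR (.cop c₀) t → U o = U' (w o) ∧ V o = V' (w o) := by
    refine fun o ho hwo => hUV o ((h.eq_or_mem_prodLeaves hwo ?_).imp (fun hc => ?_)
      h.mem_copLeaves_of_wire_mem)
    · rwa [w.symm_apply_apply]
    · exact w.injective (hc.trans h.closing.symm)
  let D := {o | o ∈ allPorts OutPort.copR OutPort.copL (.prod p₀) s}
  let U₀ := fun o => if o ∈ D then U o else U' (w o)
  let V₀ := fun o => if o ∈ D then V o else V' (w o)
  have hU₀ : ∀ i ∈ allPorts InPort.prodL InPort.prodR (.cop c₀) t,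
      V₀ (w.symm i) = V' i ∧ U₀ (w.symm i) = U' i := fun i hi => by
    by_cases hD : w.symm i ∈ D
    · have := hcomm _ hD (by rwa [w.apply_symm_apply])
      simpa [U₀, V₀, hD] using this.symm
    · simp [U₀, V₀, hD]
  obtain ⟨g, hg⟩ := exists_lift_of_isContour
    (h.forallNodes_cop.1 (hcop.isContour_congr (U' := U₀) (V' := V₀) fun o ho =>
      ⟨if_pos ho, if_pos ho⟩))
    (h.forallNodes_prod.1 (hprod.isContour_congr hU₀))
  refine ⟨g, ?_⟩
  rw [gapFaces, List.map_cons, List.map_map, (hg _).1, (hU₀ _ List.mem_cons_self).2]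
  exact congrArg _ (List.map_congr_left fun i hi =>
    (hg _).2.trans (hU₀ i (mem_allPorts_of_mem_leafPorts hi)).1)

theorem card_faces (h : Realizes w p₀ c₀ s t) : Nat.card (Faces w) = t.numNodes + 2 := by
  obtain ⟨g, hg⟩ := h.exists_gap_numbering (L := List.range (t.numNodes + 2)) List.length_range
  have hnodup : (gapFaces w c₀ t).Nodup := .of_map g (hg ▸ List.nodup_range)
  rw [← length_gapFaces (w := w) (c₀ := c₀), IsEnumeration.length_eq ⟨hnodup, h.mem_gapFaces⟩]

end Realizes

end Faces

/-! ### Existence of gluings -/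

theorem wellFounded_of_transGen_irrefl {A : Type} [Finite A] {r : A → A → Prop}
    (h : ∀ x, ¬ Relation.TransGen r x x) : WellFounded r :=
  have : Std.Irrefl (Relation.TransGen r) := ⟨h⟩
  Subrelation.wf Relation.TransGen.single
    (Finite.wellFounded_of_trans_of_irrefl (Relation.TransGen r))

theorem not_transGen_self_of_wellFounded {A : Type} {r : A → A → Prop} (h : WellFounded r) (x : A) :
    ¬ Relation.TransGen r x x :=
  h.transGen.irrefl.irrefl x

theorem wellFounded_swap {A : Type} [Finite A] {r : A → A → Prop} (h : WellFounded r) :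
    WellFounded (Function.swap r) :=
  wellFounded_of_transGen_irrefl fun x hx =>
    not_transGen_self_of_wellFounded h x (Relation.transGen_swap.1 hx)

theorem connected_fromRel_of_wellFounded {A : Type} {r : A → A → Prop} (hr : WellFounded r) (a : A)
    (h : ∀ x, x ≠ a → ∃ y, r y x) : (SimpleGraph.fromRel r).Connected := by
  have hreach : ∀ x, (SimpleGraph.fromRel r).Reachable a x := fun x => by
    induction x using hr.induction with
    | _ x ih =>
      by_cases hx : x = a
      · rw [hx]
      obtain ⟨y, hy⟩ := h x hx
      have hne : y ≠ x := fun hyx => hr.irrefl.irrefl x (hyx ▸ hy)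
      exact (ih y hy).trans ((SimpleGraph.fromRel_adj _ _ _).2 ⟨hne, .inl hy⟩).reachable
  exact { preconnected := fun x y => (hreach x).symm.trans (hreach y), nonempty := ⟨a⟩ }

section Existence

variable {C P : Type}

/-- The outputs as a disjoint union, for counting them. -/
def OutPort.equivSum : OutPort C P ≃ C ⊕ C ⊕ P where
  toFun
    | .copL c => .inl c
    | .copR c => .inr (.inl c)
    | .prod p => .inr (.inr p)
  invFun := Sum.elim .copL (Sum.elim .copR .prod)
  left_inv := by rintro (c | c | p) <;> rfl
  right_inv := by rintro (c | c | p) <;> rfl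

/-- The inputs as a disjoint union, for counting them. -/
def InPort.equivSum : InPort C P ≃ C ⊕ P ⊕ P where
  toFun
    | .cop c => .inl c
    | .prodL p => .inr (.inl p)
    | .prodR p => .inr (.inr p)
  invFun := Sum.elim .cop (Sum.elim .prodL .prodR)
  left_inv := by rintro (c | p | p) <;> rfl
  right_inv := by rintro (c | p | p) <;> rfl

variable [Finite C] {w : OutPort C P ≃ InPort C P} {p₀ : P} {c₀ : C} {s : BinaryTree C}
  {t : BinaryTree P}

theorem natCard_outPort [Finite P] :
    Nat.card (OutPort C P) = Nat.card C + (Nat.card C + Nat.card P) := by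
  rw [Nat.card_congr OutPort.equivSum, Nat.card_sum, Nat.card_sum]

theorem natCard_inPort [Finite P] :
    Nat.card (InPort C P) = Nat.card C + (Nat.card P + Nat.card P) := by
  rw [Nat.card_congr InPort.equivSum, Nat.card_sum, Nat.card_sum]

theorem isEnumeration_outPorts [Finite P] (hs : IsEnumeration (labels s)) {m : List P}
    (hm : IsEnumeration (p₀ :: m)) :
    IsEnumeration (innerPorts OutPort.copR OutPort.copL (.prod p₀) s ++
      ((copLeaves p₀ s).reverse ++ m.map .prod)) := by
  refine .of_mem_of_length_eq (fun o => ?_) ?_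
  · rw [← List.append_assoc, List.mem_append, List.mem_append, List.mem_reverse, ← List.mem_append,
      (innerPorts_append_leafPorts_perm _ s).mem_iff]
    cases o with
    | copL c => simpa [allPorts] using hs.mem c
    | copR c => simpa [allPorts] using hs.mem c
    | prod p => simpa [allPorts] using hm.mem p
  · have hm' := hm.length_eq
    rw [List.length_cons] at hm'
    simp only [List.length_append, List.length_reverse, List.length_map, length_innerPorts,
      length_leafPorts, natCard_outPort, ← hs.length_eq, ← length_labels]
    omega

theorem isEnumeration_inPorts [Finite P] (ht : IsEnumeration (labels t)) {l : List C}
    (hl : IsEnumeration l) {J : List (InPort C P)}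
    (hJ : innerPorts InPort.prodL InPort.prodR (.cop c₀) t = .cop c₀ :: J) :
    IsEnumeration (l.map .cop ++ (prodLeaves c₀ t ++ J)) := by
  refine .of_mem_of_length_eq (fun i => ?_) ?_
  · have hmem : i ∈ allPorts InPort.prodL InPort.prodR (.cop c₀) t →
        i = .cop c₀ ∨ i ∈ prodLeaves c₀ t ++ J := by
      rw [← (innerPorts_append_leafPorts_perm _ t).mem_iff, hJ]
      simp only [List.mem_append, List.mem_cons]
      tauto
    cases i with
    | cop c => exact List.mem_append_left _ (List.mem_map_of_mem (hl.mem c))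
    | prodL p =>
      exact List.mem_append_right _
        ((hmem (by simpa [allPorts] using ht.mem p)).resolve_left nofun)
    | prodR p =>
      exact List.mem_append_right _
        ((hmem (by simpa [allPorts] using ht.mem p)).resolve_left nofun)
  · have hJ' := congrArg List.length hJ
    rw [length_innerPorts, List.length_cons] at hJ'
    simp only [List.length_append, List.length_map, length_leafPorts, natCard_inPort, hl.length_eq,
      ← ht.length_eq, ← length_labels]
    omega

theorem exists_realizes [Finite P] {a b : BinaryTree C} {a' b' : BinaryTree P}
    (hs : IsEnumeration (labels (.node c₀ a b))) (ht : IsEnumeration (labels (.node p₀ a' b')))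
    (hcard : Nat.card C = Nat.card P) :
    ∃ w, Realizes w p₀ c₀ (.node c₀ a b) (.node p₀ a' b') := by
  have hout := isEnumeration_outPorts (p₀ := p₀) hs ht
  have hin := isEnumeration_inPorts (c₀ := c₀) ht hs rfl
  obtain ⟨w, hw⟩ := hout.exists_equiv_map_eq hin (by
    rw [hout.length_eq, hin.length_eq, natCard_outPort, natCard_inPort, hcard])
  simp only [List.map_append] at hw
  obtain ⟨hcop, hw⟩ := List.append_inj hw (by simp only [List.length_map, length_innerPorts])
  obtain ⟨hglue, hprod⟩ := List.append_inj hw (by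
    simp only [List.length_map, List.length_reverse, length_leafPorts, ← length_labels,
      hs.length_eq, ht.length_eq, hcard])
  have hunfolds := unfolds_iff_map_innerPorts_eq.2 hcop
  refine ⟨w, ⟨⟨hunfolds.1, hs, ht, hunfolds, unfolds_iff_map_innerPorts_eq.2 ?_⟩, hglue⟩⟩
  rw [innerPorts, labels, List.map_cons, List.map_cons, w.symm_apply_eq.2 hunfolds.1.symm, ← hprod]
  simp [Function.comp_def]

namespace SplitsInto

theorem wellFounded_edgeRel (h : SplitsInto w p₀ c₀ s t) : WellFounded (EdgeRel w p₀) := by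
  have hcop : WellFounded (IsChild InPort.cop OutPort.copR OutPort.copL w) := ⟨fun c =>
    h.cop.acc_of_mem_labels InPort.cop_injective (fun _ => h.wire_ne_cop) (h.cop_labels.mem c)⟩
  have hprod : WellFounded (IsChild OutPort.prod InPort.prodL InPort.prodR w.symm) := ⟨fun p =>
    h.prod.acc_of_mem_labels OutPort.prod_injective (fun _ => h.wire_symm_ne_prod)
      (h.prod_labels.mem p)⟩
  refine Subrelation.wf ?_ (Sum.lex_wf (wellFounded_swap hcop) hprod)
  rintro _ _ ⟨o, hne, rfl, rfl⟩
  cases hi : w o with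
  | cop d =>
    cases o with
    | copL c => exact .inl (.inr hi)
    | copR c => exact .inl (.inl hi)
    | prod p => exact absurd (congrArg _ (h.eq_of_wire_prod_eq_cop hi)) hne
  | prodL q =>
    cases o with
    | copL c => exact .sep _ _
    | copR c => exact .sep _ _
    | prod p => exact .inr (.inl (w.symm_apply_eq.2 hi.symm))
  | prodR q =>
    cases o with
    | copL c => exact .sep _ _
    | copR c => exact .sep _ _
    | prod p => exact .inr (.inr (w.symm_apply_eq.2 hi.symm))

theorem connected (h : SplitsInto w p₀ c₀ s t) :
    (SimpleGraph.fromRel (EdgeRel w p₀)).Connected := by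
  have hpred : ∀ i : InPort C P, i ≠ .cop c₀ → ∃ x, EdgeRel w p₀ x i.vertex := fun i hi =>
    ⟨_, w.symm i, fun hp => hi ((w.symm_apply_eq.1 hp).trans h.closing), rfl,
      congrArg _ (w.apply_symm_apply i)⟩
  refine connected_fromRel_of_wellFounded h.wellFounded_edgeRel (.inl c₀) ?_
  rintro (c | p) hne
  · exact hpred (.cop c) fun hc => hne (congrArg _ (InPort.cop.inj hc))
  · exact hpred (.prodL p) nofun

end SplitsInto

theorem LabelledPrograph.exists_realizedBy [Finite P] [Nonempty C]
    (hcard : Nat.card C = Nat.card P) (hs : IsEnumeration (labels s))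
    (ht : IsEnumeration (labels t)) : ∃ G : LabelledPrograph C P, G.RealizedBy s t := by
  have hpos : 0 < Nat.card C := Nat.card_pos
  obtain _ | ⟨c₀, a, b⟩ := s
  · exact absurd hs.length_eq hpos.ne
  obtain _ | ⟨p₀, a', b'⟩ := t
  · exact absurd (ht.length_eq.trans hcard.symm) hpos.ne
  obtain ⟨w, h⟩ := exists_realizes hs ht hcard
  refine ⟨⟨w, p₀, c₀, h.closing, h.connected,
    not_transGen_self_of_wellFounded h.wellFounded_edgeRel, ?_⟩, h⟩
  rw [h.card_faces, natCard_outPort, Nat.card_sum, ← length_labels, ht.length_eq]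
  omega

end Existence

/-! ### Rotations of gluings -/

section Rotations

variable {C P : Type} {G H K : LabelledPrograph C P} {s s' : BinaryTree C} {t t' : BinaryTree P}

namespace LabelledPrograph

/-- The prograph `H` arises from `G` by the rotation at the coproducts `x` and `y`. -/
structure CopRotatesAt (G H : LabelledPrograph C P) (x y : C) : Prop extends
    RotatesAt .cop .copR .copL G.wire H.wire x y where
  north : H.north = G.north
  other : ∀ z, z ≠ x → z ≠ y →
    H.wire (.copR z) = G.wire (.copR z) ∧ H.wire (.copL z) = G.wire (.copL z)
  prod : ∀ p, H.wire (.prod p) = G.wire (.prod p)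

/-- The prograph `H` arises from `G` by the rotation at the products `x` and `y`. -/
structure ProdRotatesAt (G H : LabelledPrograph C P) (x y : P) : Prop extends
    RotatesAt .prod .prodL .prodR G.wire.symm H.wire.symm x y where
  north : H.north = G.north
  other : ∀ z, z ≠ x → z ≠ y → H.wire.symm (.prodL z) = G.wire.symm (.prodL z) ∧
    H.wire.symm (.prodR z) = G.wire.symm (.prodR z)
  cop : ∀ c, H.wire.symm (.cop c) = G.wire.symm (.cop c)

theorem copRotation_iff : G.CopRotation H ↔ ∃ x y, G.CopRotatesAt H x y :=
  ⟨fun ⟨hn, x, y, hc, hc', hr, hm, hl, ho, hp⟩ =>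
      ⟨x, y, ⟨hc, hc', hl, hm, hr⟩, hn, fun z hx hy => (ho z hx hy).symm, hp⟩,
    fun ⟨x, y, h⟩ => ⟨h.north, x, y, h.child, h.child', h.right, h.mid, h.left,
      fun z hx hy => (h.other z hx hy).symm, h.prod⟩⟩

theorem prodRotation_iff : G.ProdRotation H ↔ ∃ x y, G.ProdRotatesAt H x y :=
  ⟨fun ⟨hn, x, y, hc, hc', hl, hm, hr, ho, hp⟩ => ⟨x, y, ⟨hc, hc', hl, hm, hr⟩, hn, ho, hp⟩,
    fun ⟨x, y, h⟩ =>
      ⟨h.north, x, y, h.child, h.child', h.left, h.mid, h.right, h.other, h.cop⟩⟩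

theorem eq_of_wire_eq (hn : G.north = H.north) (hw : G.wire = H.wire) : G = H := by
  have hs : G.south = H.south := by
    rw [← InPort.cop.injEq, ← G.closing, ← H.closing, hn, hw]
  cases G
  cases H
  congr

theorem CopRotatesAt.eq {x y : C} (h : G.CopRotatesAt H x y) (h' : G.CopRotatesAt K x y) :
    H = K :=
  have hcop := h.toRotatesAt.eq h'.toRotatesAt h.other h'.other
  eq_of_wire_eq (h.north.trans h'.north.symm) (equiv_eq_of_ports_eq (fun c => (hcop c).2)
    (fun c => (hcop c).1) fun p => (h.prod p).trans (h'.prod p).symm)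

theorem ProdRotatesAt.eq {x y : P} (h : G.ProdRotatesAt H x y) (h' : G.ProdRotatesAt K x y) :
    H = K := by
  have hprod := h.toRotatesAt.eq h'.toRotatesAt h.other h'.other
  have hw : H.wire.symm = K.wire.symm := by
    ext i
    cases i with
    | cop c => exact (h.cop c).trans (h'.cop c).symm
    | prodL p => exact (hprod p).1
    | prodR p => exact (hprod p).2
  exact eq_of_wire_eq (h.north.trans h'.north.symm)
    (Equiv.symm_bijective.injective hw)

namespace RealizedBy

theorem copRotatesAt (h : G.RealizedBy s t) (h' : H.RealizedBy s' t) {x y : C}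
    (hr : LabelledRotation x y s s') : G.CopRotatesAt H x y := by
  have hleaf : (copLeaves G.north s).map G.wire = (copLeaves H.north s').map H.wire := by
    rw [← List.reverse_inj, ← List.map_reverse, ← List.map_reverse, h.glue, h'.glue,
      h'.prodLeaves_eq]
  obtain ⟨hroot, hrot, hother⟩ := Unfolds.rotatesAt hr h.cop h'.cop hleaf
  rw [h.closing, h'.closing] at hroot
  exact ⟨hrot, h'.north_eq h.toSplitsInto, fun z => hother z (h.cop_labels.mem z),
    h'.wire_prod_eq (InPort.cop.inj hroot ▸ h.toSplitsInto)⟩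

theorem prodRotatesAt (h : G.RealizedBy s t) (h' : H.RealizedBy s t') {x y : P}
    (hr : LabelledRotation x y t t') : G.ProdRotatesAt H x y := by
  have hleaf :
      (prodLeaves G.south t).map G.wire.symm = (prodLeaves H.south t').map H.wire.symm := by
    rw [← h.glue, ← h'.glue, List.map_map, List.map_map, Equiv.symm_comp_self,
      Equiv.symm_comp_self, h'.copLeaves_eq]
  obtain ⟨hroot, hrot, hother⟩ := Unfolds.rotatesAt hr h.prod h'.prod hleaf
  rw [h.closing_symm, h'.closing_symm] at hroot
  have hnorth := OutPort.prod.inj hroot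
  exact ⟨hrot, hnorth.symm, fun z => hother z (h.prod_labels.mem z),
    h'.wire_symm_cop_eq (hnorth ▸ h.toSplitsInto)⟩

variable [Finite C] [Finite P]

theorem exists_of_perm (h : G.RealizedBy s t) (hs : (labels s).Perm (labels s'))
    (ht : (labels t).Perm (labels t')) : ∃ H : LabelledPrograph C P, H.RealizedBy s' t' := by
  have : Nonempty C := ⟨G.south⟩
  refine exists_realizedBy ?_ (h.cop_labels.perm hs) (h.prod_labels.perm ht)
  rw [← h.cop_labels.length_eq, ← h.prod_labels.length_eq, length_labels, length_labels,
    h.numNodes_eq]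

theorem exists_of_copRotation (h : G.RealizedBy s t) (hr : G.CopRotation H) :
    ∃ s', RightRotation (shape s) (shape s') ∧ H.RealizedBy s' t := by
  obtain ⟨x, y, hH⟩ := copRotation_iff.1 hr
  obtain ⟨s', hs⟩ := h.cop.exists_labelledRotation InPort.cop_injective
    (fun _ => h.wire_ne_cop) (h.cop_labels.mem x) hH.child
  obtain ⟨K, hK⟩ := h.exists_of_perm hs.labels_perm (.refl _)
  exact ⟨s', hs.rightRotation, hH.eq (h.copRotatesAt hK hs) ▸ hK⟩

theorem exists_of_prodRotation (h : G.RealizedBy s t) (hr : G.ProdRotation H) :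
    ∃ t', RightRotation (shape t) (shape t') ∧ H.RealizedBy s t' := by
  obtain ⟨x, y, hH⟩ := prodRotation_iff.1 hr
  obtain ⟨t', ht⟩ := h.prod.exists_labelledRotation OutPort.prod_injective
    (fun _ => h.wire_symm_ne_prod) (h.prod_labels.mem x) hH.child
  obtain ⟨K, hK⟩ := h.exists_of_perm (.refl _) ht.labels_perm
  exact ⟨t', ht.rightRotation, hH.eq (h.prodRotatesAt hK ht) ▸ hK⟩

theorem exists_copRotation (h : G.RealizedBy s t) {S : BinaryTree Unit}
    (hr : RightRotation (shape s) S) :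
    ∃ H s', G.CopRotation H ∧ H.RealizedBy s' t ∧ shape s' = S := by
  obtain ⟨x, y, s', hS, hs⟩ := hr.exists_labelledRotation
  obtain ⟨H, hH⟩ := h.exists_of_perm hs.labels_perm (.refl _)
  exact ⟨H, s', copRotation_iff.2 ⟨x, y, h.copRotatesAt hH hs⟩, hH, hS⟩

theorem exists_prodRotation (h : G.RealizedBy s t) {T : BinaryTree Unit}
    (hr : RightRotation (shape t) T) :
    ∃ H t', G.ProdRotation H ∧ H.RealizedBy s t' ∧ shape t' = T := by
  obtain ⟨x, y, t', hT, ht⟩ := hr.exists_labelledRotation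
  obtain ⟨H, hH⟩ := h.exists_of_perm (.refl _) ht.labels_perm
  exact ⟨H, t', prodRotation_iff.2 ⟨x, y, h.prodRotatesAt hH ht⟩, hH, hT⟩

end RealizedBy

end LabelledPrograph

end Rotations

/-! ### Avoiding prographs are gluings -/

section Gluing

variable {C P : Type} {w : OutPort C P ≃ InPort C P} {p₀ : P} {c₀ : C}

theorem edgeRel_of_isChild_cop {c d : C}
    (h : IsChild InPort.cop OutPort.copR OutPort.copL w d c) : EdgeRel w p₀ (.inl c) (.inl d) :=
  h.elim (fun hd => ⟨.copR c, nofun, rfl, congrArg _ hd⟩)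
    fun hd => ⟨.copL c, nofun, rfl, congrArg _ hd⟩

theorem edgeRel_of_isChild_prod (hw : w (.prod p₀) = .cop c₀) {p q : P}
    (h : IsChild OutPort.prod InPort.prodL InPort.prodR w.symm q p) :
    EdgeRel w p₀ (.inr q) (.inr p) := by
  simp only [IsChild, Equiv.symm_apply_eq] at h
  refine ⟨.prod q, fun hq => ?_, rfl, ?_⟩
  · rw [hq, hw] at h
    exact h.elim nofun nofun
  · exact h.elim (fun hp => congrArg _ hp.symm) fun hp => congrArg _ hp.symm

namespace LabelledPrograph

section Acyclic

variable [Finite C] [Finite P] (G : LabelledPrograph C P)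

theorem wellFounded_isChild_cop :
    WellFounded (IsChild InPort.cop OutPort.copR OutPort.copL G.wire) :=
  Subrelation.wf edgeRel_of_isChild_cop
    (InvImage.wf Sum.inl (wellFounded_swap (wellFounded_of_transGen_irrefl G.acyclic)))

theorem wellFounded_isChild_prod :
    WellFounded (IsChild OutPort.prod InPort.prodL InPort.prodR G.wire.symm) :=
  Subrelation.wf (edgeRel_of_isChild_prod G.closing)
    (InvImage.wf Sum.inr (wellFounded_of_transGen_irrefl G.acyclic))

end Acyclic

variable {G : LabelledPrograph C P} {s : BinaryTree C} {t : BinaryTree P}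
  {S S' T T' : BinaryTree Unit} {e : OutPort C P} {K K' : List (OutPort C P)}

section Finite

variable [Finite C] [Finite P]

theorem nodup_labels_cop
    (hs : Unfolds InPort.cop OutPort.copR OutPort.copL G.wire (.prod G.north) s)
    (hleaf : ∀ e ∈ copLeaves G.north s, ∀ c, G.wire e ≠ .cop c) : (labels s).Nodup :=
  hs.nodup_labels (distinctPorts_cop _) G.wire.injective InPort.cop_injective hleaf
    (wellFounded_swap G.wellFounded_isChild_cop)

theorem nodup_labels_prod
    (ht : Unfolds OutPort.prod InPort.prodL InPort.prodR G.wire.symm (.cop G.south) t)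
    (hleaf : ∀ i ∈ prodLeaves G.south t, ∀ p, G.wire.symm i ≠ .prod p) : (labels t).Nodup :=
  ht.nodup_labels (distinctPorts_prod _) G.wire.symm.injective OutPort.prod_injective hleaf
    (wellFounded_swap G.wellFounded_isChild_prod)

theorem exists_splitsInto (h : ¬ G.HasProdCopEdge) :
    ∃ s t, SplitsInto G.wire G.north G.south s t := by
  have hno : ∀ {p c}, G.wire (.prod p) = .cop c → p = G.north := fun {p c} hpc =>
    by_contra fun hp => h ⟨p, c, hp, hpc⟩
  obtain ⟨s, hs, hs'⟩ := exists_unfolds G.wellFounded_isChild_cop (.prod G.north)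
  obtain ⟨t, ht, ht'⟩ := exists_unfolds G.wellFounded_isChild_prod (.cop G.south)
  refine ⟨s, t, G.closing, ⟨nodup_labels_cop hs hs', fun c => ?_⟩,
    ⟨nodup_labels_prod ht ht', fun p => ?_⟩, hs, ht⟩
  · refine hs.mem_labels G.wire.injective InPort.cop_injective hs'
      (wellFounded_swap G.wellFounded_isChild_cop) (fun c => ?_) c
    obtain ⟨o, ho⟩ := G.wire.surjective (.cop c)
    cases o with
    | copL d => exact .inr ⟨d, .inr ho⟩
    | copR d => exact .inr ⟨d, .inl ho⟩
    | prod p => exact .inl (hno ho ▸ ho)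
  · refine ht.mem_labels G.wire.symm.injective OutPort.prod_injective ht'
      (wellFounded_swap G.wellFounded_isChild_prod) (fun p => ?_) p
    simp only [IsChild, Equiv.symm_apply_eq]
    cases hi : G.wire (.prod p) with
    | cop c => exact .inl (G.closing.symm.trans (hno hi ▸ hi))
    | prodL q => exact .inr ⟨q, .inl rfl⟩
    | prodR q => exact .inr ⟨q, .inr rfl⟩

theorem exists_realizedBy_of_not_hasProdCopEdge (hcard : Nat.card C = Nat.card P)
    (h : ¬ G.HasProdCopEdge) : ∃ s t, G.RealizedBy s t := by
  obtain ⟨s, t, hst⟩ := exists_splitsInto h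
  have hs := hst.cop_labels.length_eq
  have ht := hst.prod_labels.length_eq
  have hplanar := G.planar
  rw [natCard_outPort, Nat.card_sum] at hplanar
  rw [length_labels] at hs ht
  exact ⟨s, t, hst.realizes (by omega) (by omega)⟩

end Finite

theorem CopTree.exists_unfolds (h : CopTree G e S K) :
    ∃ s, mirror (shape s) = S ∧ Unfolds InPort.cop OutPort.copR OutPort.copL G.wire e s ∧
      K = (leafPorts OutPort.copR OutPort.copL e s).reverse ∧ ∀ o ∈ K, ∀ c, G.wire o ≠ .cop c := by
  induction h with
  | leaf e he => exact ⟨.nil, rfl, trivial, rfl, by simpa using he⟩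
  | node e c he S T K L _ _ ihS ihT =>
    obtain ⟨s, rfl, hs, rfl, hK⟩ := ihS
    obtain ⟨t, rfl, ht, rfl, hL⟩ := ihT
    exact ⟨.node c t s, rfl, ⟨he, ht, hs⟩, List.reverse_append.symm,
      fun o ho => (List.mem_append.1 ho).elim (hK o) (hL o)⟩

theorem copTree_of_unfolds (h : Unfolds InPort.cop OutPort.copR OutPort.copL G.wire e s)
    (hleaf : ∀ o ∈ leafPorts OutPort.copR OutPort.copL e s, ∀ c, G.wire o ≠ .cop c) :
    CopTree G e (mirror (shape s)) (leafPorts OutPort.copR OutPort.copL e s).reverse := by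
  induction s generalizing e with
  | nil => exact .leaf e (hleaf e List.mem_cons_self)
  | node c s t ihs iht =>
    simp only [leafPorts, List.mem_append] at hleaf
    rw [leafPorts, List.reverse_append]
    exact .node e c h.1 _ _ _ _ (iht h.2.2 fun o ho => hleaf o (.inr ho))
      (ihs h.2.1 fun o ho => hleaf o (.inl ho))

theorem ProdTree.exists_unfolds (h : ProdTree G e T K) :
    ∃ t, shape t = T ∧ Unfolds OutPort.prod InPort.prodL InPort.prodR G.wire.symm (G.wire e) t ∧
      K = (leafPorts InPort.prodL InPort.prodR (G.wire e) t).map G.wire.symm ∧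
      ∀ o ∈ K, ∀ p, o ≠ .prod p := by
  induction h with
  | leaf e he => exact ⟨.nil, rfl, trivial, by simp [leafPorts], by simpa using he⟩
  | node p S T K L _ _ ihS ihT =>
    obtain ⟨s, rfl, hs, rfl, hK⟩ := ihS
    obtain ⟨t, rfl, ht, rfl, hL⟩ := ihT
    rw [Equiv.apply_symm_apply] at hs ht
    refine ⟨.node p s t, rfl, ⟨G.wire.symm_apply_apply _, hs, ht⟩, ?_,
      fun o ho => (List.mem_append.1 ho).elim (hK o) (hL o)⟩
    rw [leafPorts, List.map_append, Equiv.apply_symm_apply, Equiv.apply_symm_apply]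

theorem prodTree_of_unfolds {i : InPort C P}
    (h : Unfolds OutPort.prod InPort.prodL InPort.prodR G.wire.symm i t)
    (hleaf : ∀ j ∈ leafPorts InPort.prodL InPort.prodR i t, ∀ p, G.wire.symm j ≠ .prod p) :
    ProdTree G (G.wire.symm i) (shape t)
      ((leafPorts InPort.prodL InPort.prodR i t).map G.wire.symm) := by
  induction t generalizing i with
  | nil => exact .leaf _ (hleaf i List.mem_cons_self)
  | node p s t ihs iht =>
    simp only [leafPorts, List.mem_append] at hleaf
    rw [h.1, leafPorts, List.map_append]
    exact .node p _ _ _ _ (ihs h.2.1 fun o ho => hleaf o (.inl ho))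
      (iht h.2.2 fun o ho => hleaf o (.inr ho))

theorem CopTree.unique (h : CopTree G e S K) (h' : CopTree G e S' K') : S = S' := by
  induction h generalizing S' K' with
  | leaf e he =>
    cases h' with
    | leaf => rfl
    | node _ c hc => exact absurd hc (he c)
  | node e c he S T _ _ _ _ ihS ihT =>
    cases h' with
    | leaf _ he' => exact absurd he (he' c)
    | node _ d hd _ _ _ _ hS hT =>
      obtain rfl : c = d := InPort.cop.inj (he.symm.trans hd)
      rw [ihS hS, ihT hT]

theorem ProdTree.unique (h : ProdTree G e T K) (h' : ProdTree G e T' K') : T = T' := by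
  induction h generalizing T' K' with
  | leaf e he =>
    cases h' with
    | leaf => rfl
    | node p => exact absurd rfl (he p)
  | node p S T _ _ _ _ ihS ihT =>
    cases h' with
    | leaf _ he => exact absurd rfl (he p)
    | node _ _ _ _ _ hS hT => rw [ihS hS, ihT hT]

theorem IsGluing.unique (h : G.IsGluing S T) (h' : G.IsGluing S' T') : S = S' ∧ T = T' := by
  obtain ⟨-, -, K, hS, hT⟩ := h
  obtain ⟨-, -, K', hS', hT'⟩ := h'
  exact ⟨hS.unique hS', hT.unique hT'⟩

theorem RealizedBy.isGluing (h : G.RealizedBy s t) : G.IsGluing (mirror (shape s)) (shape t) := by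
  have hcop := copTree_of_unfolds h.cop fun _ => h.wire_ne_cop
  have hprod := prodTree_of_unfolds h.prod fun _ => h.wire_symm_ne_prod
  rw [h.closing_symm, ← prodLeaves, ← h.glue, List.map_map, Equiv.symm_comp_self,
    List.map_id] at hprod
  refine ⟨?_, ?_, _, hcop, hprod⟩
  · rw [numNodes_mirror, numNodes_shape, ← length_labels, h.cop_labels.length_eq]
  · rw [numNodes_shape, ← length_labels, h.prod_labels.length_eq]

theorem IsGluing.exists_realizedBy [Finite C] [Finite P] (h : G.IsGluing S T) :
    ∃ s t, G.RealizedBy s t ∧ mirror (shape s) = S ∧ shape t = T := by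
  obtain ⟨hS, hT, K, hcop, hprod⟩ := h
  obtain ⟨s, rfl, hs, rfl, hs'⟩ := hcop.exists_unfolds
  obtain ⟨t, rfl, ht, hglue, ht'⟩ := hprod.exists_unfolds
  rw [G.closing] at ht hglue
  refine ⟨s, t, ⟨⟨G.closing, .of_nodup_of_length_eq (nodup_labels_cop hs ?_) ?_,
    .of_nodup_of_length_eq (nodup_labels_prod ht ?_) ?_, hs, ht⟩, ?_⟩, rfl, rfl⟩
  · exact fun e he => hs' e (List.mem_reverse.2 he)
  · rw [← hS, numNodes_mirror, numNodes_shape, length_labels]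
  · exact fun i hi => ht' _ (hglue ▸ List.mem_map_of_mem hi)
  · rw [← hT, numNodes_shape, length_labels]
  · rw [hglue, List.map_map, Equiv.self_comp_symm, List.map_id]

end LabelledPrograph

end Gluing

/-! ### The lattice of avoiding prographs -/

theorem mirror_injective : Function.Injective mirror :=
  Function.LeftInverse.injective mirror_mirror

theorem LabelledPrograph.IsGluing.of_iso {C P C' P' : Type} [Finite C] [Finite P]
    {G : LabelledPrograph C P} {H : LabelledPrograph C' P'} {S T : BinaryTree Unit}
    (h : G.IsGluing S T) (hi : G.Iso H) : H.IsGluing S T := by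
  obtain ⟨s, t, hst, rfl, rfl⟩ := h.exists_realizedBy
  obtain ⟨s', t', hst', hs, ht⟩ := hst.exists_of_iso hi
  exact hs ▸ ht ▸ hst'.isGluing

namespace PCPrograph

variable {n : ℕ} {Q R : PCPrograph n} {S T S' T' : BinaryTree Unit}
  {G H : LabelledPrograph (Fin n) (Fin n)}

theorem mk_eq_mk_iff : mk G = mk H ↔ G.Iso H :=
  Quotient.eq (r := progSetoid n)

theorem isGluing_mk : (mk G).IsGluing S T ↔ G.IsGluing S T :=
  ⟨fun ⟨_, hH, h⟩ => h.of_iso (mk_eq_mk_iff.1 hH), fun h => ⟨G, rfl, h⟩⟩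

theorem avoidsProdCop_iff : Q.AvoidsProdCop ↔ ∃ S T, Q.IsGluing S T := by
  constructor
  · intro h
    obtain ⟨G, rfl⟩ : ∃ G, mk G = Q := Quotient.exists_rep Q
    obtain ⟨s, t, hst⟩ := LabelledPrograph.exists_realizedBy_of_not_hasProdCopEdge rfl (h G rfl)
    exact ⟨_, _, isGluing_mk.2 hst.isGluing⟩
  · rintro ⟨S, T, h⟩ G rfl
    obtain ⟨s, t, hst, -⟩ := (isGluing_mk.1 h).exists_realizedBy
    exact hst.not_hasProdCopEdge

namespace IsGluing

theorem numNodes_eq (h : Q.IsGluing S T) : S.numNodes = n ∧ T.numNodes = n := by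
  obtain ⟨G, -, hS, hT, -⟩ := h
  exact ⟨hS.trans (Nat.card_fin n), hT.trans (Nat.card_fin n)⟩

theorem trees_unique (h : Q.IsGluing S T) (h' : Q.IsGluing S' T') : S = S' ∧ T = T' := by
  obtain ⟨G, rfl, hG⟩ := h
  exact hG.unique (isGluing_mk.1 h')

theorem prograph_unique (hQ : Q.IsGluing S T) (hR : R.IsGluing S T) : Q = R := by
  obtain ⟨G, rfl, hG⟩ := hQ
  obtain ⟨H, rfl, hH⟩ := hR
  obtain ⟨s, t, hst, rfl, rfl⟩ := hG.exists_realizedBy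
  obtain ⟨s', t', hst', hs, ht⟩ := hH.exists_realizedBy
  exact mk_eq_mk_iff.2 (hst.iso hst' (mirror_injective hs).symm ht.symm)

theorem exists_realizedBy (h : (mk G).IsGluing (mirror S) T) :
    ∃ s t, G.RealizedBy s t ∧ shape s = S ∧ shape t = T := by
  obtain ⟨s, t, hst, hs, ht⟩ := (isGluing_mk.1 h).exists_realizedBy
  exact ⟨s, t, hst, mirror_injective hs, ht⟩

theorem exists_rotation_left (hQ : Q.IsGluing (mirror S) T) (hr : RightRotation S S') :
    ∃ R, Q.Rotation R ∧ R.IsGluing (mirror S') T := by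
  obtain ⟨G, rfl⟩ : ∃ G, mk G = Q := Quotient.exists_rep Q
  obtain ⟨s, t, hst, rfl, rfl⟩ := hQ.exists_realizedBy
  obtain ⟨H, s', hGH, hst', rfl⟩ := hst.exists_copRotation hr
  exact ⟨mk H, ⟨G, H, rfl, rfl, .inl hGH⟩, isGluing_mk.2 hst'.isGluing⟩

theorem exists_rotation_right (hQ : Q.IsGluing (mirror S) T) (hr : RightRotation T T') :
    ∃ R, Q.Rotation R ∧ R.IsGluing (mirror S) T' := by
  obtain ⟨G, rfl⟩ : ∃ G, mk G = Q := Quotient.exists_rep Q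
  obtain ⟨s, t, hst, rfl, rfl⟩ := hQ.exists_realizedBy
  obtain ⟨H, t', hGH, hst', rfl⟩ := hst.exists_prodRotation hr
  exact ⟨mk H, ⟨G, H, rfl, rfl, .inr hGH⟩, isGluing_mk.2 hst'.isGluing⟩

end IsGluing

theorem exists_isGluing (hn : 1 ≤ n) (hS : S.numNodes = n) (hT : T.numNodes = n) :
    ∃ Q : PCPrograph n, Q.IsGluing (mirror S) T := by
  have : Nonempty (Fin n) := Fin.pos_iff_nonempty.1 hn
  have hlabels : IsEnumeration (List.finRange n) := ⟨List.nodup_finRange n, List.mem_finRange⟩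
  obtain ⟨s, rfl, hs⟩ := exists_shape_eq_labels_eq S (List.length_finRange.trans hS.symm)
  obtain ⟨t, rfl, ht⟩ := exists_shape_eq_labels_eq T (List.length_finRange.trans hT.symm)
  obtain ⟨G, hG⟩ := LabelledPrograph.exists_realizedBy rfl (hs ▸ hlabels) (ht ▸ hlabels)
  exact ⟨mk G, isGluing_mk.2 hG.isGluing⟩

theorem Rotation.rightRotation (h : Q.Rotation R) (hQ : Q.IsGluing (mirror S) T)
    (hR : R.IsGluing (mirror S') T') :
    (RightRotation S S' ∧ T = T') ∨ (S = S' ∧ RightRotation T T') := by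
  obtain ⟨G, H, rfl, rfl, hr⟩ := h
  obtain ⟨s, t, hst, rfl, rfl⟩ := hQ.exists_realizedBy
  rcases hr with hr | hr
  · obtain ⟨s', hs, hst'⟩ := hst.exists_of_copRotation hr
    obtain ⟨hS, rfl⟩ := hR.trees_unique (isGluing_mk.2 hst'.isGluing)
    exact .inl ⟨mirror_injective hS ▸ hs, rfl⟩
  · obtain ⟨t', ht, hst'⟩ := hst.exists_of_prodRotation hr
    obtain ⟨hS, rfl⟩ := hR.trees_unique (isGluing_mk.2 hst'.isGluing)
    exact .inr ⟨(mirror_injective hS).symm, ht⟩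

end PCPrograph

theorem exists_lattice_of_equiv {α β : Type*} [Lattice β] (e : α ≃ β) {r : α → α → Prop}
    (h : ∀ a b, e a ≤ e b ↔ r a b) : ∃ L : Lattice α, ∀ a b, L.le a b ↔ r a b := by
  let : LE α := ⟨r⟩
  let : LT α := ⟨fun a b => e a < e b⟩
  let : Max α := ⟨fun a b => e.symm (e a ⊔ e b)⟩
  let : Min α := ⟨fun a b => e.symm (e a ⊓ e b)⟩
  exact ⟨e.injective.lattice e (h _ _) Iff.rfl (fun _ _ => e.apply_symm_apply _)
    fun _ _ => e.apply_symm_apply _, fun _ _ => Iff.rfl⟩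

namespace AvoidingPrograph

variable {n : ℕ} {Q R : AvoidingPrograph n} {S T S' T' : BinaryTree Unit}

theorem exists_isGluing (Q : AvoidingPrograph n) :
    ∃ x : Tamari n × Tamari n, Q.1.IsGluing (mirror x.1.1) x.2.1 := by
  obtain ⟨S, T, h⟩ := PCPrograph.avoidsProdCop_iff.1 Q.2
  obtain ⟨hS, hT⟩ := h.numNodes_eq
  exact ⟨(⟨mirror S, (numNodes_mirror S).trans hS⟩, ⟨T, hT⟩), (mirror_mirror S).symm ▸ h⟩

/-- The two trees whose gluing is the avoiding prograph `Q`; the tree of coproducts is turned by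
half a turn, so that the Tamari order on both trees is given by the rotations of `Q`. -/
noncomputable def trees (Q : AvoidingPrograph n) : Tamari n × Tamari n :=
  Q.exists_isGluing.choose

theorem isGluing_trees (Q : AvoidingPrograph n) :
    Q.1.IsGluing (mirror Q.trees.1.1) Q.trees.2.1 :=
  Q.exists_isGluing.choose_spec

theorem trees_eq {x : Tamari n × Tamari n} (h : Q.1.IsGluing (mirror x.1.1) x.2.1) :
    Q.trees = x := by
  obtain ⟨hS, hT⟩ := Q.isGluing_trees.trees_unique h
  exact Prod.ext (Subtype.ext (mirror_injective hS)) (Subtype.ext hT)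

theorem trees_injective : Function.Injective (trees : AvoidingPrograph n → _) := fun Q R h =>
  Subtype.ext (Q.isGluing_trees.prograph_unique (h ▸ R.isGluing_trees))

theorem trees_surjective (hn : 1 ≤ n) : Function.Surjective (trees : AvoidingPrograph n → _) := by
  intro x
  obtain ⟨Q, hQ⟩ := PCPrograph.exists_isGluing hn x.1.2 x.2.2
  exact ⟨⟨Q, PCPrograph.avoidsProdCop_iff.2 ⟨_, _, hQ⟩⟩, trees_eq hQ⟩

theorem Reaches.trees_le (h : Q.Reaches R) : Q.trees ≤ R.trees := by
  induction h with
  | refl => exact ⟨.refl, .refl⟩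
  | @tail R R' _ hr ih =>
    rcases hr.rightRotation R.isGluing_trees R'.isGluing_trees with ⟨hS, hT⟩ | ⟨hS, hT⟩
    · exact ⟨ih.1.tail hS, Subtype.ext hT ▸ ih.2⟩
    · exact ⟨Subtype.ext hS ▸ ih.1, ih.2.tail hT⟩

theorem exists_reaches_left (hQ : Q.1.IsGluing (mirror S) T)
    (h : ReflTransGen RightRotation S S') :
    ∃ R : AvoidingPrograph n, Q.Reaches R ∧ R.1.IsGluing (mirror S') T := by
  induction h with
  | refl => exact ⟨Q, .refl, hQ⟩
  | tail _ hr ih =>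
    obtain ⟨R, hQR, hR⟩ := ih
    obtain ⟨R', hRR', hR'⟩ := hR.exists_rotation_left hr
    exact ⟨⟨R', PCPrograph.avoidsProdCop_iff.2 ⟨_, _, hR'⟩⟩, hQR.tail hRR', hR'⟩

theorem exists_reaches_right (hQ : Q.1.IsGluing (mirror S) T)
    (h : ReflTransGen RightRotation T T') :
    ∃ R : AvoidingPrograph n, Q.Reaches R ∧ R.1.IsGluing (mirror S) T' := by
  induction h with
  | refl => exact ⟨Q, .refl, hQ⟩
  | tail _ hr ih =>
    obtain ⟨R, hQR, hR⟩ := ih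
    obtain ⟨R', hRR', hR'⟩ := hR.exists_rotation_right hr
    exact ⟨⟨R', PCPrograph.avoidsProdCop_iff.2 ⟨_, _, hR'⟩⟩, hQR.tail hRR', hR'⟩

theorem trees_le_iff : Q.trees ≤ R.trees ↔ Q.Reaches R := by
  refine ⟨fun ⟨hS, hT⟩ => ?_, Reaches.trees_le⟩
  obtain ⟨M, hQM, hM⟩ := exists_reaches_left Q.isGluing_trees hS
  obtain ⟨R', hMR', hR'⟩ := exists_reaches_right hM hT
  rw [trees_injective (trees_eq hR').symm]
  exact hQM.trans hMR'

/-- The isomorphism between the avoiding prographs, ordered by rotations, and the pairs of trees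
in the Tamari order. -/
noncomputable def treesOrderIso (hn : 1 ≤ n) : AvoidingPrograph n ≃o Tamari n × Tamari n where
  toEquiv := .ofBijective trees ⟨trees_injective, trees_surjective hn⟩
  map_rel_iff' := trees_le_iff

theorem exists_lattice (hn : 1 ≤ n) :
    ∃ L : Lattice (AvoidingPrograph n), ∀ Q R : AvoidingPrograph n, L.le Q R ↔ Q.Reaches R := by
  obtain ⟨L, hL⟩ := Tamari.exists_lattice n
  refine exists_lattice_of_equiv (treesOrderIso hn).toEquiv fun Q R => ?_
  rw [← trees_le_iff]
  exact and_congr (hL _ _) (hL _ _)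

end AvoidingPrograph

/-- The PC prographs of size `n` without an edge from a product output to a coproduct input are
exactly the gluings of a tree of coproducts with a tree of products; with the two classical
rotations they form a lattice, isomorphic to the product of the Tamari lattice with itself through
the two trees. -/
theorem theorem3 (n : ℕ) (hn : 1 ≤ n) :
    (∀ Q : PCPrograph n,
      Q.AvoidsProdCop ↔ ∃ S T : BinaryTree Unit, Q.IsGluing S T) ∧
    (∃ L : Lattice (Tamari n), ∀ S T : Tamari n, L.le S T ↔ S.Reaches T) ∧
    (∃ L : Lattice (AvoidingPrograph n), ∀ Q R : AvoidingPrograph n, L.le Q R ↔ Q.Reaches R) ∧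
    ∃ e : AvoidingPrograph n ≃o Tamari n × Tamari n,
      ∀ Q : AvoidingPrograph n, Q.1.IsGluing (mirror (e Q).1.1) (e Q).2.1 :=
  ⟨fun _ => PCPrograph.avoidsProdCop_iff, Tamari.exists_lattice n,
    AvoidingPrograph.exists_lattice hn, AvoidingPrograph.treesOrderIso hn,
    AvoidingPrograph.isGluing_trees⟩
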